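/- Let $J_1,J_2,\dots$ be independent random variables, $J_n$ uniformly distributed on $\{0,\dots,n-1\}$, and let the tree on $\{0,1,2,\dots\}$ rooted at $0$ in which $J_k$ is the parent of $k\ge 1$ be the (infinite) random recursive tree (the Hoppe tree with parameter $\theta=1$). Let $D_k$ be the distance of vertex $k$ to the root $0$, let $D_{ij}$ be the distance to the root of the last common vertex of the paths from $0$ to $i$ and from $0$ to $j$, and put $$T_n=\sum_{k=0}^{n-1}D_k,\qquad R_n=\sum_{0\le i<j\le n-1}D_{ij},\qquad U_n=T_n+2R_n .$$ Then $U_n/n^2$ converges in distribution as $n\to\infty$ to a random variable $U$ which solves the fixpoint equation $$U\overset{d}{=}V^2U^\ast+(1-V)^2U+V^2,$$ where $U,U^\ast,V$ are independent, $V$ is uniformly distributed on $[0,1]$ and $U\overset{d}{=}U^\ast$. Moreover $U\ge 0$ almost surely, $U$ is square integrable, and $$\mathbb{E}U=1,\qquad \mathbb{E}U^2=\tfrac{11}{9}.$$ In particular, let $\sigma>0$ and let $X_0=0$ and, for $n\ge 1$, let the conditional distribution of $X_n$ given $X_0,\dots,X_{n-1}$ and the whole tree $(J_k)_{k\ge1}$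 be the normal distribution $N(X_{J_n},\sigma^2)$. Then the barycentre $S_n=\frac1n\sum_{k=0}^{n-1}X_k$ of $X_0,\dots,X_{n-1}$ converges in distribution to the mixed centred normal distribution with random variance $\sigma^2U$, that is, to the distribution $\int N(0,v)\,\rho(dv)$ where $\rho$ is the distribution of $\sigma^2U$. This random variance has expectation $\sigma^2$ and variance $\tfrac29\sigma^4$. -/

import Mathlib

open MeasureTheory ProbabilityTheory Filter Set
open scoped NNReal ENNReal

/-! ### Trees given by a parent function

A parent function `j` (with `j k < k` for `k ≥ 1`) describes a tree on `{0, 1, 2, …}` rooted at `0`.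
Only the values `j k` with `k ≥ 1` matter. -/

/-- The set of vertices of the path from the root `0` to `k`, constructed backwards by going from
`k` to its parent `j k` and repeating. Since the path is strictly increasing, this set determines it
as a sequence. (The branch `j k ≥ k` is reached for `k = 0`; for `k ≥ 1` it is a dummy value.) -/
def treePath (j : ℕ → ℕ) (k : ℕ) : Finset ℕ :=
  if _h : j k < k then insert k (treePath j (j k)) else {k}
termination_by k

/-- `D_k`: the number of steps from the root to `k`. -/
def depth (j : ℕ → ℕ) (k : ℕ) : ℕ := (treePath j k).card - 1

/-- The last vertex that the paths from the root to `i` and to `k` have in common. -/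
def lastCommon (j : ℕ → ℕ) (i k : ℕ) : ℕ := (treePath j i ∩ treePath j k).sup id

/-- `D_{ik}`: the distance to the root of the last common vertex of the two paths. -/
def commonDepth (j : ℕ → ℕ) (i k : ℕ) : ℕ := depth j (lastCommon j i k)

/-- `T_n = ∑_{k=0}^{n-1} D_k`, the total length of the tree on `{0, …, n-1}`. -/
def totalLength (j : ℕ → ℕ) (n : ℕ) : ℕ := ∑ k ∈ Finset.range n, depth j k

/-- `R_n = ∑_{0 ≤ i < k ≤ n-1} D_{ik}`. -/
def pairSum (j : ℕ → ℕ) (n : ℕ) : ℕ :=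
  ∑ k ∈ Finset.range n, ∑ i ∈ Finset.range k, commonDepth j i k

/-- `U_n = T_n + 2 R_n`. -/
def treeU (j : ℕ → ℕ) (n : ℕ) : ℕ := totalLength j n + 2 * pairSum j n

/-! ### The Hoppe tree and the random recursive set -/

/-- `J_1, J_2, …` are independent, `J_n` takes the value `0` with probability `θ / (θ + n - 1)` and
each value `1, …, n-1` with probability `1 / (θ + n - 1)`. Thus `k ↦ J_k` is the parent function of
a Hoppe tree with parameter `θ`. (The function `J 0` plays no role.) -/
structure IsHoppeSequence {Ω : Type*} [MeasurableSpace Ω] (θ : ℝ) (J : ℕ → Ω → ℕ)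
    (P : Measure Ω) : Prop where
  measurable : ∀ n, 1 ≤ n → Measurable (J n)
  indep : iIndepFun (fun n : ℕ => J (n + 1)) P
  prob_zero : ∀ n : ℕ, 1 ≤ n → P {ω | J n ω = 0} = ENNReal.ofReal (θ / (θ + n - 1))
  prob_pos : ∀ n k : ℕ, 1 ≤ k → k < n → P {ω | J n ω = k} = ENNReal.ofReal (1 / (θ + n - 1))

/-- The σ-algebra generated by `X_0, …, X_{n-1}` and the whole sequence `J_1, J_2, …`. -/
abbrev history {Ω E : Type*} [MeasurableSpace E] (J : ℕ → Ω → ℕ) (X : ℕ → Ω → E) (n : ℕ) :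
    MeasurableSpace Ω :=
  (⨆ i : Fin n, MeasurableSpace.comap (X i) inferInstance) ⊔
    (⨆ k : ℕ, MeasurableSpace.comap (J (k + 1)) inferInstance)

/-- The random recursive set with jump kernel `κ` on the Hoppe tree given by `J`: `X_0 = 0`, and
given the tree and `X_0, …, X_{n-1}`, the point `X_n` has distribution `κ (X_{J_n}, ·)`. -/
structure IsRecursiveSet {Ω E : Type*} [MeasurableSpace Ω] [MeasurableSpace E] [Zero E]
    (θ : ℝ) (κ : Kernel E E) (J : ℕ → Ω → ℕ) (X : ℕ → Ω → E) (P : Measure Ω) : Prop where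
  hoppe : IsHoppeSequence θ J P
  measurable : ∀ n, Measurable (X n)
  start : ∀ᵐ ω ∂P, X 0 ω = 0
  jump : ∀ n, 1 ≤ n → ∀ B : Set E, MeasurableSet B →
    (P⟦X n ⁻¹' B|history J X n⟧) =ᵐ[P] fun ω => (κ (X (J n ω) ω)).real B

/-- The barycentre `S_n` of `X_0, …, X_{n-1}`. -/
noncomputable def barycentre {Ω : Type*} (X : ℕ → Ω → ℝ) (n : ℕ) (ω : Ω) : ℝ :=
  (1 / (n : ℝ)) * ∑ k ∈ Finset.range n, X k ω

/-! ### Normal kernels and mixtures of centred normal distributions -/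

/-- The normal kernel `κ(x, ·) = N(x, v)`. -/
noncomputable def normalKernel (v : ℝ≥0) : Kernel ℝ ℝ where
  toFun x := gaussianReal x v
  measurable' := measurable_gaussianReal.comp (by fun_prop : Measurable fun x : ℝ => (x, v))

/-- The kernel `v ↦ N(0, v)`, for `v ≥ 0`. -/
noncomputable def centredNormalKernel : Kernel ℝ ℝ where
  toFun v := gaussianReal 0 v.toNNReal
  measurable' := measurable_gaussianReal.comp (by fun_prop : Measurable fun v : ℝ => ((0 : ℝ), v.toNNReal))

/-- The mixed centred normal distribution `∫ N(0, v) ρ(dv)`, where `ρ` is the distribution of the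
random variance. -/
noncomputable def mixedCentredNormal (ρ : Measure ℝ) : Measure ℝ := ρ.bind centredNormalKernel

/-! ### The tree functional as a sum of squares -/

/-! `D_{ik}` counts the non-root vertices that are ancestors of both `i` and `k`. Since `U_n` is the
sum of `D_{ik}` over all ordered pairs, diagonal included, it equals the sum over non-root `v` of
the squared size of the subtree at `v` (`treeU_succ_eq_subtreeSq`).

A recursive tree splits at vertex 1 into the subtree of 1 and the rest; given the sizes these are
independent recursive trees, and the size is uniform. In characteristic functions this is the
recursion `treeCharFun_succ`, a discrete form of the fixpoint equation with `V = (k + 1) / (n + 2)`.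
It comes from a finite identity for sums over weighted trees, `treeSum_append`, which
`integral_exp_subtreeSq` links to the random tree.

The fixpoint map contracts the distance `sup |φ(t) - ψ(t)| / |t|` by `E(V² + (1 - V)²) = 2/3`, so
its iterates from the unit mass at 0 converge to a fixpoint. Once square integrability is known, the
equation itself determines the two moments (`exists_fixMap_eq`). Comparing the recursion with the
integral equation gives an error of order `|t| log n / n` (`norm_treeCharFun_sub_le`), hence
convergence of `U_n / n²`.

With normal jumps, given the tree, a combination `∑ A_k X_k` is centred normal, with variance `σ²`
times the sum of squared subtree weights (`integral_mul_exp_sum`). For equal weights `1/n` this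
variance is `σ² U_n / n²`, so the law of the barycentre follows by testing the convergence of `U_n /
n²` against one bounded continuous function. -/

lemma treePath_of_lt {j : ℕ → ℕ} {k : ℕ} (h : j k < k) :
    treePath j k = insert k (treePath j (j k)) := by
  rw [treePath]; simp [h]

lemma self_mem_treePath (j : ℕ → ℕ) (k : ℕ) : k ∈ treePath j k := by
  rw [treePath]; split_ifs <;> simp

lemma le_of_mem_treePath {j : ℕ → ℕ} {v k : ℕ} (h : v ∈ treePath j k) : v ≤ k := by
  induction k using Nat.strong_induction_on with
  | _ k ih =>
    rw [treePath] at h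
    split_ifs at h with hk
    · rcases Finset.mem_insert.1 h with rfl | h
      · exact le_rfl
      · exact (ih _ hk h).trans hk.le
    · exact (Finset.mem_singleton.1 h).le

lemma zero_mem_treePath {j : ℕ → ℕ} (hj : ∀ k, 1 ≤ k → j k < k) (k : ℕ) : 0 ∈ treePath j k := by
  induction k using Nat.strong_induction_on with
  | _ k ih =>
    rcases Nat.eq_zero_or_pos k with rfl | hk
    · exact self_mem_treePath j 0
    · rw [treePath_of_lt (hj k hk)]
      exact Finset.mem_insert_of_mem (ih _ (hj k hk))

lemma treePath_subset {j : ℕ → ℕ} {v k : ℕ} (h : v ∈ treePath j k) :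
    treePath j v ⊆ treePath j k := by
  induction k using Nat.strong_induction_on with
  | _ k ih =>
    by_cases hk : j k < k
    · rw [treePath_of_lt hk] at h
      rcases Finset.mem_insert.1 h with rfl | h
      · exact subset_rfl
      · rw [treePath_of_lt hk]
        exact (ih _ hk h).trans (Finset.subset_insert _ _)
    · rw [treePath] at h
      simp only [hk, dite_false, Finset.mem_singleton] at h
      rw [h]

lemma mem_treePath_of_le {j : ℕ → ℕ} {u v k : ℕ} (hu : u ∈ treePath j k) (hv : v ∈ treePath j k)
    (huv : u ≤ v) : u ∈ treePath j v := by
  induction k using Nat.strong_induction_on with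
  | _ k ih =>
    by_cases hk : j k < k
    · have hu' := hu
      rw [treePath_of_lt hk] at hu hv
      rcases Finset.mem_insert.1 hv with rfl | hv
      · exact hu'
      · rcases Finset.mem_insert.1 hu with rfl | hu
        · exact absurd (le_of_mem_treePath hv) (by omega)
        · exact ih _ hk hu hv
    · rw [treePath] at hu hv
      simp only [hk, dite_false, Finset.mem_singleton] at hu hv
      rw [hu, hv]
      exact self_mem_treePath j k

/-- Paths are closed under passing to ancestors, and on one path the smaller of two vertices is an
ancestor of the larger. So the common vertices are exactly the ancestors of the largest one. -/
lemma treePath_lastCommon {j : ℕ → ℕ} (hj : ∀ k, 1 ≤ k → j k < k) (i k : ℕ) :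
    treePath j (lastCommon j i k) = treePath j i ∩ treePath j k := by
  have hmem : lastCommon j i k ∈ treePath j i ∩ treePath j k := by
    have hne : (treePath j i ∩ treePath j k).Nonempty :=
      ⟨0, Finset.mem_inter.2 ⟨zero_mem_treePath hj i, zero_mem_treePath hj k⟩⟩
    obtain ⟨m, hm, hm'⟩ := Finset.exists_mem_eq_sup _ hne id
    rw [lastCommon, hm']
    exact hm
  obtain ⟨h1, h2⟩ := Finset.mem_inter.1 hmem
  refine Finset.Subset.antisymm
    (Finset.subset_inter (treePath_subset h1) (treePath_subset h2)) fun u hu => ?_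
  exact mem_treePath_of_le (Finset.mem_inter.1 hu).1 h1 (Finset.le_sup (f := id) hu)

lemma commonDepth_eq_sum {j : ℕ → ℕ} (hj : ∀ k, 1 ≤ k → j k < k) {i k n : ℕ} (hi : i ≤ n) :
    (commonDepth j i k : ℝ) = ∑ v ∈ Finset.Icc 1 n,
      (if v ∈ treePath j i then 1 else 0) * (if v ∈ treePath j k then 1 else 0) := by
  have hset : (treePath j i ∩ treePath j k).erase 0
      = {v ∈ Finset.Icc 1 n | v ∈ treePath j i ∧ v ∈ treePath j k} := by
    ext v
    simp only [Finset.mem_erase, Finset.mem_inter, Finset.mem_filter, Finset.mem_Icc]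
    constructor
    · rintro ⟨h0, h⟩
      exact ⟨⟨Nat.one_le_iff_ne_zero.2 h0, (le_of_mem_treePath h.1).trans hi⟩, h⟩
    · rintro ⟨h0, h⟩
      exact ⟨by omega, h⟩
  have h0 : 0 ∈ treePath j i ∩ treePath j k :=
    Finset.mem_inter.2 ⟨zero_mem_treePath hj i, zero_mem_treePath hj k⟩
  rw [commonDepth, depth, treePath_lastCommon hj, ← Finset.card_erase_of_mem h0, hset,
    Finset.card_filter]
  push_cast
  refine Finset.sum_congr rfl fun v _ => ?_
  by_cases h1 : v ∈ treePath j i <;> by_cases h2 : v ∈ treePath j k <;> simp [h1, h2]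

lemma commonDepth_comm (j : ℕ → ℕ) (i k : ℕ) : commonDepth j i k = commonDepth j k i := by
  rw [commonDepth, commonDepth, lastCommon, lastCommon, Finset.inter_comm]

lemma commonDepth_self (j : ℕ → ℕ) (k : ℕ) : commonDepth j k k = depth j k := by
  have : lastCommon j k k = k := by
    rw [lastCommon, Finset.inter_self]
    exact le_antisymm (Finset.sup_le fun v hv => le_of_mem_treePath hv)
      (Finset.le_sup (f := id) (self_mem_treePath j k))
  rw [commonDepth, this]

lemma treeU_eq_sum_commonDepth (j : ℕ → ℕ) (n : ℕ) :
    treeU j n = ∑ i ∈ Finset.range n, ∑ k ∈ Finset.range n, commonDepth j i k := by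
  induction n with
  | zero => simp [treeU, totalLength, pairSum]
  | succ n ih =>
    have h : treeU j (n + 1) = treeU j n + depth j n
        + 2 * ∑ i ∈ Finset.range n, commonDepth j i n := by
      simp only [treeU, totalLength, pairSum, Finset.sum_range_succ]
      ring
    have hc : ∑ i ∈ Finset.range n, commonDepth j n i
        = ∑ i ∈ Finset.range n, commonDepth j i n :=
      Finset.sum_congr rfl fun i _ => commonDepth_comm j n i
    simp only [h, ih, Finset.sum_range_succ, Finset.sum_add_distrib, commonDepth_self, hc]
    ring

/-- For a tree on `{0, …, n}` whose vertices carry weights `w`, the sum over all vertices `v ≠ 0` of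
the squared total weight of the subtree rooted at `v`, computed by successively removing the last
vertex and moving its weight to its parent. -/
def subtreeSq (j : ℕ → ℕ) : ℕ → (ℕ → ℝ) → ℝ
  | 0, _ => 0
  | n + 1, w => w (n + 1) ^ 2
      + subtreeSq j n fun p => w p + if p = j (n + 1) then w (n + 1) else 0

/-- A vertex `v ≤ n` is an ancestor of `n + 1` exactly when it is one of the parent of `n + 1`, so
moving the last weight to the parent leaves the subtree weight at `v` unchanged. The subtree of the
last vertex is that vertex alone. -/
lemma subtreeSq_eq_sum {j : ℕ → ℕ} (hj : ∀ k, 1 ≤ k → j k < k) (n : ℕ) (w : ℕ → ℝ) :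
    subtreeSq j n w = ∑ v ∈ Finset.Icc 1 n,
      (∑ i ∈ Finset.range (n + 1), w i * if v ∈ treePath j i then 1 else 0) ^ 2 := by
  induction n generalizing w with
  | zero => simp [subtreeSq]
  | succ n ih =>
    have hlt : j (n + 1) < n + 1 := hj (n + 1) (by omega)
    rw [subtreeSq, ih, Finset.sum_Icc_succ_top (by omega), add_comm]
    congr 1
    · refine Finset.sum_congr rfl fun v hv => ?_
      have hv' := Finset.mem_Icc.1 hv
      congr 1
      rw [Finset.sum_range_succ _ (n + 1)]
      simp only [add_mul, Finset.sum_add_distrib]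
      congr 1
      have hiff : v ∈ treePath j (n + 1) ↔ v ∈ treePath j (j (n + 1)) := by
        rw [treePath_of_lt hlt, Finset.mem_insert, or_iff_right (by omega)]
      rw [Finset.sum_eq_single_of_mem (j (n + 1)) (Finset.mem_range.2 hlt)
        fun i _ hi => by simp [hi]]
      simp [hiff]
    · congr 1
      rw [Finset.sum_range_succ, Finset.sum_eq_zero, zero_add]
      · simp [self_mem_treePath]
      · intro i hi
        have : n + 1 ∉ treePath j i := fun h =>
          absurd (le_of_mem_treePath h) (by have := Finset.mem_range.1 hi; omega)
        simp [this]

lemma treeU_succ_eq_subtreeSq {j : ℕ → ℕ} (hj : ∀ k, 1 ≤ k → j k < k) (n : ℕ) :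
    (treeU j (n + 1) : ℝ) = subtreeSq j n fun _ => 1 := by
  rw [subtreeSq_eq_sum hj, treeU_eq_sum_commonDepth]
  push_cast
  have h : ∀ i ∈ Finset.range (n + 1), ∑ k ∈ Finset.range (n + 1), (commonDepth j i k : ℝ)
      = ∑ k ∈ Finset.range (n + 1), ∑ v ∈ Finset.Icc 1 n,
      (if v ∈ treePath j i then 1 else 0) * (if v ∈ treePath j k then 1 else 0) := fun i hi =>
    Finset.sum_congr rfl fun k _ =>
      commonDepth_eq_sum hj (Nat.lt_succ_iff.1 (Finset.mem_range.1 hi))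
  rw [Finset.sum_congr rfl h]
  simp only [one_mul, sq, Finset.sum_mul_sum]
  exact (Finset.sum_congr rfl fun i _ => Finset.sum_comm).trans Finset.sum_comm

lemma subtreeSq_nonneg (j : ℕ → ℕ) (n : ℕ) (w : ℕ → ℝ) : 0 ≤ subtreeSq j n w := by
  induction n generalizing w with
  | zero => simp [subtreeSq]
  | succ n ih => exact add_nonneg (sq_nonneg _) (ih _)

lemma subtreeSq_smul (j : ℕ → ℕ) (n : ℕ) (c : ℝ) (w : ℕ → ℝ) :
    subtreeSq j n (fun p => c * w p) = c ^ 2 * subtreeSq j n w := by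
  induction n generalizing w with
  | zero => simp [subtreeSq]
  | succ n ih =>
    simp only [subtreeSq]
    rw [mul_add, ← ih, mul_pow]
    congr 2
    ext p
    split_ifs <;> ring

/-! ### Splitting a weighted recursive tree at its first vertex -/

/-- The sum of `g l'` over all lists `l'` obtained from `l` by adding `x` to one entry. -/
def bumpSum (x : ℝ) : List ℝ → (List ℝ → ℂ) → ℂ
  | [], _ => 0
  | y :: l, g => g ((x + y) :: l) + bumpSum x l fun l' => g (y :: l')

/-- The sum of `g a b` over all ways to split `l` into complementary sublists `a` and `b`. -/
def splitSum : List ℝ → (List ℝ → List ℝ → ℂ) → ℂ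
  | [], g => g [] []
  | x :: l, g => splitSum l fun a b => g (x :: a) b + g a (x :: b)

lemma bumpSum_add (x : ℝ) (l : List ℝ) (g h : List ℝ → ℂ) :
    bumpSum x l (fun l' => g l' + h l') = bumpSum x l g + bumpSum x l h := by
  induction l generalizing g h with
  | nil => simp [bumpSum]
  | cons y l ih => simp only [bumpSum, ih]; ring

lemma bumpSum_mul_left (x : ℝ) (l : List ℝ) (c : ℂ) (g : List ℝ → ℂ) :
    bumpSum x l (fun l' => c * g l') = c * bumpSum x l g := by
  induction l generalizing g with
  | nil => simp [bumpSum]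
  | cons y l ih => simp only [bumpSum, ih]; ring

/-- Bumping keeps the length and adds `x` to the total; functions need only agree on such lists. -/
lemma bumpSum_congr {x : ℝ} {l : List ℝ} {g h : List ℝ → ℂ}
    (H : ∀ l' : List ℝ, l'.length = l.length → l'.sum = x + l.sum → g l' = h l') :
    bumpSum x l g = bumpSum x l h := by
  induction l generalizing g h with
  | nil => rfl
  | cons y l ih =>
    simp only [bumpSum]
    rw [H _ (by simp) (by simp [add_assoc]), ih fun l' h1 h2 => H _ (by simp [h1]) (by simp [h2]; ring)]

lemma bumpSum_append (x : ℝ) (l m : List ℝ) (g : List ℝ → ℂ) :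
    bumpSum x (l ++ m) g
      = bumpSum x l (fun l' => g (l' ++ m)) + bumpSum x m (fun m' => g (l ++ m')) := by
  induction l generalizing g with
  | nil => simp [bumpSum]
  | cons y l ih => simp only [List.cons_append, bumpSum, ih]; ring

lemma splitSum_add (l : List ℝ) (g h : List ℝ → List ℝ → ℂ) :
    splitSum l (fun a b => g a b + h a b) = splitSum l g + splitSum l h := by
  induction l generalizing g h with
  | nil => simp [splitSum]
  | cons x l ih => simp only [splitSum, ← ih]; congr; ext; ring

lemma splitSum_mul_left (l : List ℝ) (c : ℂ) (g : List ℝ → List ℝ → ℂ) :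
    splitSum l (fun a b => c * g a b) = c * splitSum l g := by
  induction l generalizing g with
  | nil => simp [splitSum]
  | cons x l ih => simp only [splitSum, ← ih]; congr; ext; ring

/-- The bumped entry lands in one of the two halves, so bumping and then splitting amounts to
splitting and then bumping either half. -/
lemma bumpSum_splitSum (x : ℝ) (l : List ℝ) (g : List ℝ → List ℝ → ℂ) :
    bumpSum x l (fun l' => splitSum l' g)
      = splitSum l fun a b => bumpSum x a (fun a' => g a' b) + bumpSum x b (g a) := by
  induction l generalizing g with
  | nil => simp [bumpSum, splitSum]
  | cons y l ih =>
    simp only [bumpSum, splitSum, ih, bumpSum_add, ← splitSum_add]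
    congr; ext a b; ring

/-- The sum of `exp (s Q)` over all recursive trees on the entries of the list (from the last vertex
to the root), where `Q` is the sum of the squared subtree weights of the non-root vertices; the first
argument bounds the number of vertices other than the root. -/
noncomputable def treeSumAux (s : ℂ) : ℕ → List ℝ → ℂ
  | n + 1, x :: l => Complex.exp (s * x ^ 2) * bumpSum x l (treeSumAux s n)
  | _, _ => 1

/-- The sum of `exp (s Q)` over all recursive trees on the entries of the list. -/
noncomputable def treeSum (s : ℂ) (l : List ℝ) : ℂ := treeSumAux s (l.length - 1) l

lemma treeSum_singleton (s : ℂ) (x : ℝ) : treeSum s [x] = 1 := by simp [treeSum, treeSumAux]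

lemma treeSum_cons (s : ℂ) (x : ℝ) {l : List ℝ} (hl : l ≠ []) :
    treeSum s (x :: l) = Complex.exp (s * x ^ 2) * bumpSum x l (treeSum s) := by
  obtain ⟨y, l, rfl⟩ := List.exists_cons_of_ne_nil hl
  rw [treeSum, List.length_cons, Nat.add_sub_cancel, List.length_cons, treeSumAux]
  congr 1
  refine bumpSum_congr fun l' h _ => ?_
  simp [treeSum, h]

/-- The last two entries `v`, `u` are the weights of vertices 1 and 0; `a` lists the other vertices
below 1, and `b` the rest. Induction removes the youngest vertex `x`, whose parent lies in `l` or is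
1 or 0; on the split side these cases become attaching `x` to `a ++ [v]` or to `b ++ [u]`. Arbitrary
weights are needed because removing a vertex destroys equality of weights. -/
lemma treeSum_append (s : ℂ) (l : List ℝ) (v u : ℝ) :
    treeSum s (l ++ [v, u]) = splitSum l fun a b =>
      Complex.exp (s * (a.sum + v) ^ 2) * (treeSum s (a ++ [v]) * treeSum s (b ++ [u])) := by
  induction hn : l.length generalizing l v u with
  | zero =>
    obtain rfl := List.length_eq_zero_iff.1 hn
    simp [splitSum, treeSum_cons, treeSum_singleton, bumpSum]
  | succ n ih =>
    obtain ⟨x, l, rfl⟩ := List.exists_cons_of_length_eq_add_one hn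
    simp only [List.length_cons, Nat.add_right_cancel_iff] at hn
    have h1 : bumpSum x l (fun l' => treeSum s (l' ++ [v, u]))
        = bumpSum x l fun l' => splitSum l' fun a b =>
          Complex.exp (s * (a.sum + v) ^ 2) * (treeSum s (a ++ [v]) * treeSum s (b ++ [u])) :=
      bumpSum_congr fun l' h _ => ih l' v u (h.trans hn)
    rw [List.cons_append, treeSum_cons _ _ (by simp), bumpSum_append, h1, bumpSum_splitSum]
    simp only [bumpSum, add_zero]
    rw [ih l (x + v) u hn, ih l v (x + u) hn, ← splitSum_add, ← splitSum_add, ← splitSum_mul_left,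
      splitSum]
    congr; ext a b
    have h2 : bumpSum x a (fun a' => Complex.exp (s * (a'.sum + v) ^ 2)
          * (treeSum s (a' ++ [v]) * treeSum s (b ++ [u])))
        = Complex.exp (s * (x + a.sum + v) ^ 2) * treeSum s (b ++ [u])
          * bumpSum x a fun a' => treeSum s (a' ++ [v]) := by
      rw [← bumpSum_mul_left]
      refine bumpSum_congr fun a' _ h => ?_
      rw [h]; push_cast; ring
    have h3 : bumpSum x b (fun b' => Complex.exp (s * (a.sum + v) ^ 2)
          * (treeSum s (a ++ [v]) * treeSum s (b' ++ [u])))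
        = Complex.exp (s * (a.sum + v) ^ 2) * treeSum s (a ++ [v])
          * bumpSum x b fun b' => treeSum s (b' ++ [u]) := by
      rw [← bumpSum_mul_left]
      refine bumpSum_congr fun b' _ _ => ?_
      ring
    rw [h2, h3, List.cons_append, List.cons_append, treeSum_cons _ _ (by simp),
      treeSum_cons _ _ (by simp), bumpSum_append, bumpSum_append]
    simp only [bumpSum, add_zero, List.sum_cons]
    push_cast
    have e1 : (a.sum : ℂ) + (x + v) = x + a.sum + v := by ring
    rw [e1]
    ring

lemma splitSum_replicate (n : ℕ) (x : ℝ) (g : List ℝ → List ℝ → ℂ) :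
    splitSum (List.replicate n x) g = ∑ p ∈ Finset.HasAntidiagonal.antidiagonal n,
      (n.choose p.1 : ℂ) * g (List.replicate p.1 x) (List.replicate p.2 x) := by
  induction n generalizing g with
  | zero => simp [splitSum]
  | succ n ih =>
    rw [List.replicate_succ, splitSum, ih]
    simp only [mul_add, Finset.sum_add_distrib]
    have := Finset.sum_antidiagonal_choose_succ_nsmul (M := ℂ)
      (fun a b => g (List.replicate a x) (List.replicate b x)) n
    simp only [nsmul_eq_mul] at this
    rw [this, add_comm]
    congr 1
    refine Finset.sum_congr rfl fun p hp => ?_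
    -- Pascal's rule yields the second sum with the binomial coefficient indexed by `p.2`.
    rw [Nat.choose_symm_of_eq_add (Finset.HasAntidiagonal.mem_antidiagonal.1 hp).symm]
    rfl

lemma treeSum_replicate (s : ℂ) (n : ℕ) :
    treeSum s (List.replicate (n + 2) 1) = ∑ p ∈ Finset.HasAntidiagonal.antidiagonal n,
      (n.choose p.1 : ℂ) * (Complex.exp (s * (p.1 + 1) ^ 2) *
        (treeSum s (List.replicate (p.1 + 1) 1) * treeSum s (List.replicate (p.2 + 1) 1))) := by
  have h : List.replicate (n + 2) (1 : ℝ) = List.replicate n 1 ++ [1, 1] := by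
    rw [List.replicate_add]; rfl
  rw [h, treeSum_append, splitSum_replicate]
  refine Finset.sum_congr rfl fun p _ => ?_
  simp [List.replicate_succ']

/-! ### The characteristic function of the tree functional -/

/-- The list `[w n, …, w 0]`. -/
def weightList : ℕ → (ℕ → ℝ) → List ℝ
  | 0, w => [w 0]
  | n + 1, w => w (n + 1) :: weightList n w

lemma weightList_ne_nil (n : ℕ) (w : ℕ → ℝ) : weightList n w ≠ [] := by
  cases n <;> simp [weightList]

lemma weightList_congr {n : ℕ} {w w' : ℕ → ℝ} (h : ∀ p ≤ n, w p = w' p) :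
    weightList n w = weightList n w' := by
  induction n with
  | zero => simp [weightList, h 0]
  | succ n ih => rw [weightList, weightList, h _ le_rfl, ih fun p hp => h p (by omega)]

lemma weightList_const (n : ℕ) (x : ℝ) :
    weightList n (fun _ => x) = List.replicate (n + 1) x := by
  induction n with
  | zero => rfl
  | succ n ih => rw [weightList, ih]; rfl

lemma bumpSum_weightList (x : ℝ) (n : ℕ) (w : ℕ → ℝ) (g : List ℝ → ℂ) :
    bumpSum x (weightList n w) g = ∑ p ∈ Finset.range (n + 1),
      g (weightList n fun q => w q + if q = p then x else 0) := by
  induction n generalizing g with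
  | zero => simp [weightList, bumpSum, add_comm]
  | succ n ih =>
    rw [weightList, bumpSum, ih, Finset.sum_range_succ _ (n + 1), add_comm]
    congr 1
    · refine Finset.sum_congr rfl fun p hp => ?_
      have : n + 1 ≠ p := by have := Finset.mem_range.1 hp; omega
      simp [weightList, this]
    · rw [weightList]
      simp only [if_true, add_comm x]
      congr 2
      refine weightList_congr fun p hp => ?_
      rw [if_neg (by omega), add_zero]

lemma subtreeSq_congr {j j' : ℕ → ℕ} {n : ℕ} (h : ∀ k, 1 ≤ k → k ≤ n → j k = j' k)
    (w : ℕ → ℝ) : subtreeSq j n w = subtreeSq j' n w := by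
  induction n generalizing w with
  | zero => rfl
  | succ n ih =>
    rw [subtreeSq, subtreeSq, h (n + 1) (by omega) le_rfl,
      ih fun k h1 h2 => h k h1 (by omega)]

lemma measurable_subtreeSq {Ω : Type*} {m : MeasurableSpace Ω} {J : ℕ → Ω → ℕ}
    (hJ : ∀ k, 1 ≤ k → Measurable (J k)) (n : ℕ) {W : Ω → ℕ → ℝ}
    (hW : ∀ p, Measurable fun ω => W ω p) :
    Measurable fun ω => subtreeSq (fun k => J k ω) n (W ω) := by
  induction n generalizing W with
  | zero => simp only [subtreeSq]; fun_prop
  | succ n ih =>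
    simp only [subtreeSq]
    refine ((hW _).pow_const 2).add (ih fun p => (hW p).add ?_)
    refine Measurable.ite ?_ (hW _) measurable_const
    exact measurableSet_eq_fun measurable_const (hJ _ (by omega))

lemma norm_exp_ofReal_mul_I_mul (t x : ℝ) : ‖Complex.exp (t * Complex.I * x)‖ = 1 := by
  rw [show (t * Complex.I * x : ℂ) = ((t * x : ℝ) : ℂ) * Complex.I by push_cast; ring]
  exact Complex.norm_exp_ofReal_mul_I _

namespace IsHoppeSequence

variable {Ω : Type*} [MeasurableSpace Ω] {P : Measure Ω} {J : ℕ → Ω → ℕ}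

lemma prob_eq (h : IsHoppeSequence 1 J P) {n k : ℕ} (hk : k < n) :
    P {ω | J n ω = k} = ENNReal.ofReal (1 / n) := by
  have e : (1 : ℝ) + n - 1 = n := by ring
  rcases Nat.eq_zero_or_pos k with rfl | hk0
  · rw [h.prob_zero n (by omega), e]
  · rw [h.prob_pos n k hk0 hk, e]

/-- The `n` prescribed point masses `1/n` already add up to 1. -/
lemma ae_lt [IsProbabilityMeasure P] (h : IsHoppeSequence 1 J P) :
    ∀ᵐ ω ∂P, ∀ k, 1 ≤ k → J k ω < k := by
  refine ae_all_iff.2 fun n => ?_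
  rcases Nat.eq_zero_or_pos n with rfl | hn
  · simp
  have hm := h.measurable n hn
  have hset : {ω | J n ω < n} = ⋃ k ∈ Finset.range n, J n ⁻¹' {k} := by
    ext ω; simp
  have hP : P {ω | J n ω < n} = 1 := by
    rw [hset, measure_biUnion_finset]
    · have : ∀ k ∈ Finset.range n, P (J n ⁻¹' {k}) = ENNReal.ofReal (1 / n) := fun k hk =>
        h.prob_eq (Finset.mem_range.1 hk)
      rw [Finset.sum_congr rfl this, Finset.sum_const, Finset.card_range, nsmul_eq_mul,
        ← ENNReal.ofReal_natCast, ← ENNReal.ofReal_mul (by positivity),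
        mul_one_div_cancel (by positivity), ENNReal.ofReal_one]
    · intro a _ b _ hab
      exact Disjoint.preimage _ (by simpa using hab)
    · exact fun k _ => hm (measurableSet_singleton k)
  have hms : MeasurableSet {ω | J n ω < n} := hm (measurableSet_Iio)
  filter_upwards [(prob_compl_eq_zero_iff hms).2 hP |> (measure_eq_zero_iff_ae_notMem).1] with ω hω _
  simpa using hω

lemma indepFun_subtreeSq (h : IsHoppeSequence 1 J P) (n : ℕ) (w : ℕ → ℝ) :
    IndepFun (fun ω => subtreeSq (fun k => J k ω) n w) (J (n + 1)) P := by
  classical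
  have hind := h.indep.indepFun_finset (Finset.range n) {n} (by simp)
    fun i => h.measurable (i + 1) (by omega)
  -- Coordinate `i` carries `J (i + 1)`, hence the shift by one. The default 0 is never read, as
  -- `subtreeSq` uses only `1 ≤ k ≤ n`.
  let f : (Finset.range n → ℕ) → ℝ := fun x =>
    subtreeSq (fun k => if hk : k - 1 ∈ Finset.range n then x ⟨k - 1, hk⟩ else 0) n w
  have hf : Measurable f := Measurable.of_discrete
  have hg : Measurable fun x : ({n} : Finset ℕ) → ℕ => x ⟨n, by simp⟩ := measurable_pi_apply _
  convert hind.comp hf hg using 1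
  · ext ω
    refine subtreeSq_congr (fun k h1 h2 => ?_) w
    rw [dif_pos (Finset.mem_range.2 (by omega))]
    change J k ω = J (k - 1 + 1) ω
    rw [Nat.sub_add_cancel h1]
  · rfl

/-- `J (n + 1)` is uniform on `n + 1` values and independent of the earlier parents. Averaging over
it is a bump sum divided by `n + 1`, and the factorial collects these divisors. -/
lemma integral_exp_subtreeSq [IsProbabilityMeasure P] (h : IsHoppeSequence 1 J P) (t : ℝ) (n : ℕ)
    (w : ℕ → ℝ) :
    (n.factorial : ℂ) * ∫ ω, Complex.exp (t * Complex.I * subtreeSq (fun k => J k ω) n w) ∂P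
      = treeSum (t * Complex.I) (weightList n w) := by
  induction n generalizing w with
  | zero => simp [subtreeSq, weightList, treeSum_singleton]
  | succ n ih =>
    set x := w (n + 1)
    let w' : ℕ → ℕ → ℝ := fun p q => w q + if q = p then x else 0
    have hmeas : ∀ p, Measurable fun ω => subtreeSq (fun k => J k ω) n (w' p) := fun p =>
      measurable_subtreeSq h.measurable n fun _ => measurable_const
    have hcexp : Measurable fun y : ℝ => Complex.exp (t * Complex.I * y) := by fun_prop
    have hJm : Measurable (J (n + 1)) := h.measurable (n + 1) (by omega)
    let ind : ℕ → ℕ → ℂ := fun p k => if k = p then 1 else 0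
    have hind : ∀ p, Measurable (ind p) := fun p => Measurable.of_discrete
    have hJint : ∀ p ∈ Finset.range (n + 1), ∫ ω, ind p (J (n + 1) ω) ∂P = 1 / (n + 1 : ℂ) := by
      intro p hp
      have e : (fun ω => ind p (J (n + 1) ω)) = {ω | J (n + 1) ω = p}.indicator fun _ => (1 : ℂ) := by
        ext ω; simp [ind, Set.indicator]
      have hms : MeasurableSet {ω | J (n + 1) ω = p} := hJm (measurableSet_singleton p)
      rw [e, integral_indicator hms, setIntegral_const, measureReal_def,
        h.prob_eq (Finset.mem_range.1 hp), ENNReal.toReal_ofReal (by positivity)]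
      simp
    have hprod : ∀ p ∈ Finset.range (n + 1),
        ∫ ω, Complex.exp (t * Complex.I * subtreeSq (fun k => J k ω) n (w' p))
            * ind p (J (n + 1) ω) ∂P
          = (∫ ω, Complex.exp (t * Complex.I * subtreeSq (fun k => J k ω) n (w' p)) ∂P)
            * (1 / (n + 1 : ℂ)) := by
      intro p hp
      have hI := (h.indepFun_subtreeSq n (w' p)).comp hcexp (hind p)
      have := hI.integral_fun_mul_eq_mul_integral
        (hcexp.comp (hmeas p)).aestronglyMeasurable ((hind p).comp hJm).aestronglyMeasurable
      simp only [Function.comp_apply] at this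
      rw [this, hJint p hp]
    have hae : (fun ω => Complex.exp (t * Complex.I * subtreeSq (fun k => J k ω) (n + 1) w))
        =ᵐ[P] fun ω => Complex.exp (t * Complex.I * x ^ 2) * ∑ p ∈ Finset.range (n + 1),
          Complex.exp (t * Complex.I * subtreeSq (fun k => J k ω) n (w' p))
            * ind p (J (n + 1) ω) := by
      filter_upwards [h.ae_lt] with ω hω
      rw [Finset.sum_eq_single_of_mem (J (n + 1) ω)
        (Finset.mem_range.2 (hω (n + 1) (by omega))) fun p _ hp => by simp [ind, hp.symm]]
      simp only [ind, if_true, mul_one, subtreeSq, ← Complex.exp_add]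
      congr 1
      push_cast
      ring
    rw [integral_congr_ae hae, integral_const_mul, integral_finsetSum, Finset.sum_congr rfl hprod,
      weightList, treeSum_cons _ _ (weightList_ne_nil n w), bumpSum_weightList]
    · simp only [← ih, ← Finset.sum_mul, ← Finset.mul_sum, Nat.factorial_succ]
      push_cast
      have : (n : ℂ) + 1 ≠ 0 := by exact_mod_cast Nat.succ_ne_zero n
      field_simp
      rfl
    · intro p _
      refine Integrable.of_bound (C := 1)
        ((hcexp.comp (hmeas p)).mul ((hind p).comp hJm)).aestronglyMeasurable (ae_of_all _ fun ω => ?_)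
      rw [norm_mul, norm_exp_ofReal_mul_I_mul, one_mul]
      simp only [ind]
      split_ifs <;> simp

end IsHoppeSequence

/-- The characteristic function of `U_{n+1}`. -/
noncomputable def treeCharFun (n : ℕ) (t : ℝ) : ℂ :=
  treeSum (t * Complex.I) (List.replicate (n + 1) 1) / n.factorial

lemma IsHoppeSequence.integral_exp_treeU {Ω : Type*} [MeasurableSpace Ω] {P : Measure Ω}
    [IsProbabilityMeasure P] {J : ℕ → Ω → ℕ} (h : IsHoppeSequence 1 J P) (t : ℝ) (n : ℕ) :
    ∫ ω, Complex.exp (t * Complex.I * subtreeSq (fun k => J k ω) n fun _ => 1) ∂P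
      = treeCharFun n t := by
  rw [treeCharFun, ← weightList_const, ← h.integral_exp_subtreeSq, mul_div_cancel_left₀]
  exact_mod_cast n.factorial_ne_zero

lemma treeCharFun_zero (t : ℝ) : treeCharFun 0 t = 1 := by
  simp [treeCharFun, treeSum_singleton]

/-- The binomial coefficient cancels against the factorials, so the size `k + 1` of the subtree at
vertex 1 is uniform on `1, …, n + 1`. -/
lemma treeCharFun_succ (n : ℕ) (t : ℝ) :
    treeCharFun (n + 1) t = (1 / (n + 1 : ℂ)) * ∑ k ∈ Finset.range (n + 1),
      Complex.exp (t * Complex.I * (k + 1 : ℝ) ^ 2) * (treeCharFun k t * treeCharFun (n - k) t) := by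
  rw [treeCharFun, treeSum_replicate, Nat.factorial_succ, Finset.sum_div, Finset.mul_sum,
    ← Finset.Nat.sum_antidiagonal_eq_sum_range_succ
      (fun a b => (1 / (n + 1 : ℂ)) * (Complex.exp (t * Complex.I * (a + 1 : ℝ) ^ 2)
        * (treeCharFun a t * treeCharFun b t)))]
  refine Finset.sum_congr rfl fun p hp => ?_
  have hp' := Finset.HasAntidiagonal.mem_antidiagonal.1 hp
  have hc : (n.choose p.1 : ℂ) * p.1.factorial * p.2.factorial = n.factorial := by
    have := Nat.choose_mul_factorial_mul_factorial (n := n) (k := p.1) (by omega)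
    rw [show n - p.1 = p.2 by omega] at this
    exact_mod_cast this
  have h1 : (p.1.factorial : ℂ) ≠ 0 := by exact_mod_cast p.1.factorial_ne_zero
  have h2 : (p.2.factorial : ℂ) ≠ 0 := by exact_mod_cast p.2.factorial_ne_zero
  have h3 : (n.choose p.1 : ℂ) ≠ 0 := by
    exact_mod_cast (Nat.choose_pos (n := n) (k := p.1) (by omega)).ne'
  have h4 : (n : ℂ) + 1 ≠ 0 := by exact_mod_cast Nat.succ_ne_zero n
  simp only [treeCharFun]
  push_cast
  rw [← hc]
  field_simp

lemma norm_treeCharFun_le_one (n : ℕ) (t : ℝ) : ‖treeCharFun n t‖ ≤ 1 := by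
  induction n using Nat.strong_induction_on with
  | _ n ih =>
    cases n with
    | zero => simp [treeCharFun_zero]
    | succ n =>
      have hterm : ∀ k ∈ Finset.range (n + 1),
          ‖Complex.exp (t * Complex.I * (k + 1 : ℝ) ^ 2)
            * (treeCharFun k t * treeCharFun (n - k) t)‖ ≤ 1 := by
        intro k hk
        have hk' := Finset.mem_range.1 hk
        have := norm_exp_ofReal_mul_I_mul t ((k + 1 : ℝ) ^ 2)
        rw [Complex.ofReal_pow] at this
        rw [norm_mul, norm_mul, this, one_mul]
        exact mul_le_one₀ (ih k (by omega)) (norm_nonneg _) (ih (n - k) (by omega))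
      have hs := norm_sum_le_of_le _ hterm
      rw [treeCharFun_succ, norm_mul]
      have hn : ‖(1 / (n + 1 : ℂ))‖ = 1 / (n + 1 : ℝ) := by
        rw [norm_div, norm_one]
        congr 1
        exact_mod_cast Complex.norm_natCast (n + 1)
      rw [hn, one_div, inv_mul_le_iff₀ (by positivity)]
      simpa using hs

/-! ### The fixpoint equation -/

/-- The uniform distribution on `[0, 1]`. -/
noncomputable abbrev unifMeasure : Measure ℝ := volume.restrict (Icc (0 : ℝ) 1)

instance : IsProbabilityMeasure unifMeasure := ⟨by simp⟩

/-- The distribution of `V² U* + (1 - V)² U + V²`, where `V` is uniform on `[0, 1]`, `U` and `U*`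
have distribution `μ`, and the three are independent. -/
noncomputable def fixMap (μ : Measure ℝ) : Measure ℝ :=
  (unifMeasure.prod (μ.prod μ)).map fun p => p.1 ^ 2 * p.2.1 + (1 - p.1) ^ 2 * p.2.2 + p.1 ^ 2

lemma measurable_fixFun : Measurable fun p : ℝ × ℝ × ℝ =>
    p.1 ^ 2 * p.2.1 + (1 - p.1) ^ 2 * p.2.2 + p.1 ^ 2 := by fun_prop

instance (μ : Measure ℝ) [IsProbabilityMeasure μ] : IsProbabilityMeasure (fixMap μ) :=
  Measure.isProbabilityMeasure_map measurable_fixFun.aemeasurable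

lemma integral_unif_eq {E : Type*} [NormedAddCommGroup E] [NormedSpace ℝ E] (f : ℝ → E) :
    ∫ v, f v ∂unifMeasure = ∫ v in (0 : ℝ)..1, f v := by
  rw [intervalIntegral.integral_of_le zero_le_one, integral_Icc_eq_integral_Ioc]

lemma integrable_unif_of_continuous {E : Type*} [NormedAddCommGroup E] {f : ℝ → E}
    (hf : Continuous f) : Integrable f unifMeasure :=
  hf.continuousOn.integrableOn_compact isCompact_Icc

lemma charFun_fixMap (μ : Measure ℝ) [IsProbabilityMeasure μ] (t : ℝ) :
    charFun (fixMap μ) t = ∫ v, Complex.exp (t * Complex.I * v ^ 2)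
      * (charFun μ (t * v ^ 2) * charFun μ (t * (1 - v) ^ 2)) ∂unifMeasure := by
  have hcont : Continuous fun x : ℝ => Complex.exp (t * x * Complex.I) := by fun_prop
  have hint : Integrable (fun p : ℝ × ℝ × ℝ => Complex.exp
      (t * ((p.1 ^ 2 * p.2.1 + (1 - p.1) ^ 2 * p.2.2 + p.1 ^ 2 : ℝ)) * Complex.I))
      (unifMeasure.prod (μ.prod μ)) := by
    refine Integrable.of_bound (C := 1)
      (hcont.measurable.comp measurable_fixFun).aestronglyMeasurable (ae_of_all _ fun p => ?_)
    rw [← Complex.ofReal_mul, Complex.norm_exp_ofReal_mul_I]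
  rw [charFun_apply_real, fixMap, integral_map measurable_fixFun.aemeasurable
    hcont.aestronglyMeasurable, integral_prod _ hint]
  refine integral_congr_ae (ae_of_all _ fun v => ?_)
  simp only [charFun_apply_real]
  rw [← integral_prod_mul, ← integral_const_mul]
  refine integral_congr_ae (ae_of_all _ fun q => ?_)
  simp only [← Complex.exp_add]
  congr 1
  push_cast
  ring

lemma norm_mul_sub_mul_le {a b a' b' : ℂ} (ha : ‖a'‖ ≤ 1) (hb : ‖b‖ ≤ 1) :
    ‖a * b - a' * b'‖ ≤ ‖a - a'‖ + ‖b - b'‖ := by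
  have e : a * b - a' * b' = (a - a') * b + a' * (b - b') := by ring
  rw [e]
  refine (norm_add_le _ _).trans ?_
  rw [norm_mul, norm_mul]
  exact add_le_add (mul_le_of_le_one_right (norm_nonneg _) hb)
    (mul_le_of_le_one_left (norm_nonneg _) ha)

/-- The two factors have arguments `t v²` and `t (1 - v)²`, so the Lipschitz-type bound is
multiplied by `∫ v² + (1 - v)² = 2/3`. -/
lemma norm_charFun_fixMap_sub_le {μ ν : Measure ℝ} [IsProbabilityMeasure μ]
    [IsProbabilityMeasure ν] {c : ℝ} (h : ∀ t, ‖charFun μ t - charFun ν t‖ ≤ c * |t|) (t : ℝ) :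
    ‖charFun (fixMap μ) t - charFun (fixMap ν) t‖ ≤ 2 / 3 * c * |t| := by
  have hint : ∀ (ρ : Measure ℝ) [IsProbabilityMeasure ρ], Integrable (fun v : ℝ =>
      Complex.exp (t * Complex.I * v ^ 2) * (charFun ρ (t * v ^ 2) * charFun ρ (t * (1 - v) ^ 2)))
      unifMeasure := fun ρ _ => by
    refine integrable_unif_of_continuous ?_
    have : Continuous (charFun ρ) := continuous_charFun
    fun_prop
  rw [charFun_fixMap, charFun_fixMap, ← integral_sub (hint μ) (hint ν)]
  have hb : ∀ v : ℝ, ‖Complex.exp (t * Complex.I * v ^ 2)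
        * (charFun μ (t * v ^ 2) * charFun μ (t * (1 - v) ^ 2)) - Complex.exp (t * Complex.I * v ^ 2)
        * (charFun ν (t * v ^ 2) * charFun ν (t * (1 - v) ^ 2))‖
      ≤ c * |t| * (v ^ 2 + (1 - v) ^ 2) := by
    intro v
    have hn := norm_exp_ofReal_mul_I_mul t (v ^ 2)
    rw [Complex.ofReal_pow] at hn
    rw [← mul_sub, norm_mul, hn, one_mul]
    refine (norm_mul_sub_mul_le (norm_charFun_le_one _) (norm_charFun_le_one _)).trans ?_
    refine (add_le_add (h _) (h _)).trans (le_of_eq ?_)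
    rw [abs_mul, abs_mul, abs_of_nonneg (sq_nonneg v), abs_of_nonneg (sq_nonneg (1 - v))]
    ring
  refine (norm_integral_le_of_norm_le
    (integrable_unif_of_continuous (by fun_prop)) (ae_of_all _ hb)).trans (le_of_eq ?_)
  have e : (fun v : ℝ => c * |t| * (v ^ 2 + (1 - v) ^ 2))
      = fun v : ℝ => (c * |t|) * (1 - 2 * v + 2 * v ^ 2) := by ext v; ring
  rw [e, integral_const_mul, integral_unif_eq]
  have : ∫ v in (0 : ℝ)..1, (1 - 2 * v + 2 * v ^ 2) = 2 / 3 := by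
    rw [intervalIntegral.integral_add (Continuous.intervalIntegrable (by fun_prop) _ _)
      (Continuous.intervalIntegrable (by fun_prop) _ _), intervalIntegral.integral_sub
      (Continuous.intervalIntegrable (by fun_prop) _ _)
      (Continuous.intervalIntegrable (by fun_prop) _ _), intervalIntegral.integral_const_mul,
      intervalIntegral.integral_const_mul, integral_id, integral_pow]
    simp
    norm_num
  rw [this]
  ring

lemma fixMap_nonneg {μ : Measure ℝ} [IsProbabilityMeasure μ] (h : ∀ᵐ x ∂μ, 0 ≤ x) :
    ∀ᵐ x ∂(fixMap μ), 0 ≤ x := by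
  rw [fixMap, ae_map_iff measurable_fixFun.aemeasurable measurableSet_Ici]
  have h1 : ∀ᵐ p ∂(unifMeasure.prod (μ.prod μ)), 0 ≤ p.2.1 :=
    (Measure.quasiMeasurePreserving_fst.comp Measure.quasiMeasurePreserving_snd).ae h
  have h2 : ∀ᵐ p ∂(unifMeasure.prod (μ.prod μ)), 0 ≤ p.2.2 :=
    (Measure.quasiMeasurePreserving_snd.comp Measure.quasiMeasurePreserving_snd).ae h
  filter_upwards [h1, h2] with p hp1 hp2
  positivity

/-! ### First two moments under the fixpoint map -/

section Moments

variable {μ : Measure ℝ} [IsProbabilityMeasure μ]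

lemma integral_mul_prod_unif {f g h : ℝ → ℝ} {a b c : ℝ} (hf : Continuous f)
    (hfa : ∫ v in (0 : ℝ)..1, f v = a) (hg : Integrable g μ ∧ ∫ x, g x ∂μ = b)
    (hh : Integrable h μ ∧ ∫ x, h x ∂μ = c) :
    Integrable (fun p : ℝ × ℝ × ℝ => f p.1 * (g p.2.1 * h p.2.2)) (unifMeasure.prod (μ.prod μ)) ∧
      ∫ p : ℝ × ℝ × ℝ, f p.1 * (g p.2.1 * h p.2.2) ∂(unifMeasure.prod (μ.prod μ))
        = a * (b * c) := by
  refine ⟨(integrable_unif_of_continuous hf).mul_prod (hg.1.mul_prod hh.1), ?_⟩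
  rw [integral_prod_mul (μ := unifMeasure) f fun q : ℝ × ℝ => g q.1 * h q.2,
    integral_prod_mul (μ := μ) (ν := μ) g h, integral_unif_eq, hfa, hg.2, hh.2]

lemma integrable_and_integral_add {α : Type*} [MeasurableSpace α] {ρ : Measure α} {f g : α → ℝ}
    {a b : ℝ} (hf : Integrable f ρ ∧ ∫ x, f x ∂ρ = a) (hg : Integrable g ρ ∧ ∫ x, g x ∂ρ = b) :
    Integrable (fun x => f x + g x) ρ ∧ ∫ x, f x + g x ∂ρ = a + b :=
  ⟨hf.1.add hg.1, by rw [integral_add hf.1 hg.1, hf.2, hg.2]⟩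

lemma integral_one_sub_pow (n : ℕ) : ∫ v in (0 : ℝ)..1, (1 - v) ^ n = 1 / (n + 1) := by
  rw [intervalIntegral.integral_comp_sub_left (fun v => v ^ n)]
  simp

lemma integral_unit_pow (n : ℕ) : ∫ v in (0 : ℝ)..1, v ^ n = 1 / (n + 1) := by simp

lemma integral_fixMap (h : Integrable (fun x => x) μ) :
    Integrable (fun x => x) (fixMap μ) ∧
      ∫ x, x ∂(fixMap μ) = 2 / 3 * (∫ x, x ∂μ) + 1 / 3 := by
  have h0 : Integrable (fun _ : ℝ => (1 : ℝ)) μ ∧ ∫ _, (1 : ℝ) ∂μ = 1 :=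
    ⟨integrable_const 1, by simp⟩
  have j := integrable_and_integral_add (integrable_and_integral_add
    (integral_mul_prod_unif (by fun_prop) (integral_unit_pow 2) ⟨h, rfl⟩ h0)
    (integral_mul_prod_unif (by fun_prop) (integral_one_sub_pow 2) h0 ⟨h, rfl⟩))
    (integral_mul_prod_unif (by fun_prop) (integral_unit_pow 2) h0 h0)
  simp only [one_mul, mul_one] at j
  rw [fixMap, integral_map measurable_fixFun.aemeasurable (by fun_prop),
    integrable_map_measure (by fun_prop) measurable_fixFun.aemeasurable]
  refine ⟨j.1, j.2.trans ?_⟩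
  push_cast
  ring

lemma integral_sq_fixMap (h : Integrable (fun x => x) μ) (h2 : Integrable (fun x => x ^ 2) μ) :
    Integrable (fun x => x ^ 2) (fixMap μ) ∧
      ∫ x, x ^ 2 ∂(fixMap μ) = 2 / 5 * (∫ x, x ^ 2 ∂μ) + 1 / 15 * (∫ x, x ∂μ) ^ 2
        + 7 / 15 * (∫ x, x ∂μ) + 1 / 5 := by
  have h0 : Integrable (fun _ : ℝ => (1 : ℝ)) μ ∧ ∫ _, (1 : ℝ) ∂μ = 1 :=
    ⟨integrable_const 1, by simp⟩
  have hb : ∫ v in (0 : ℝ)..1, v ^ 2 * (1 - v) ^ 2 = 1 / 30 := by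
    have e : (fun v : ℝ => v ^ 2 * (1 - v) ^ 2) = fun v => v ^ 2 - 2 * v ^ 3 + v ^ 4 := by
      ext v; ring
    rw [e, intervalIntegral.integral_add (Continuous.intervalIntegrable (by fun_prop) _ _)
      (Continuous.intervalIntegrable (by fun_prop) _ _), intervalIntegral.integral_sub
      (Continuous.intervalIntegrable (by fun_prop) _ _)
      (Continuous.intervalIntegrable (by fun_prop) _ _), intervalIntegral.integral_const_mul,
      integral_unit_pow, integral_unit_pow, integral_unit_pow]
    norm_num
  have hb2 : ∫ v in (0 : ℝ)..1, 2 * (v ^ 2 * (1 - v) ^ 2) = 1 / 15 := by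
    rw [intervalIntegral.integral_const_mul, hb]; norm_num
  have hb4 : ∫ v in (0 : ℝ)..1, 2 * v ^ 4 = 2 / 5 := by
    rw [intervalIntegral.integral_const_mul, integral_unit_pow]; norm_num
  -- The six terms of the expanded square, each a product of a function of `V`, one of `U*` and one
  -- of `U`.
  have j := integrable_and_integral_add (integrable_and_integral_add (integrable_and_integral_add
    (integrable_and_integral_add (integrable_and_integral_add
    (integral_mul_prod_unif (by fun_prop) (integral_unit_pow 4) ⟨h2, rfl⟩ h0)
    (integral_mul_prod_unif (by fun_prop) (integral_one_sub_pow 4) h0 ⟨h2, rfl⟩))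
    (integral_mul_prod_unif (by fun_prop) hb2 ⟨h, rfl⟩ ⟨h, rfl⟩))
    (integral_mul_prod_unif (by fun_prop) hb4 ⟨h, rfl⟩ h0))
    (integral_mul_prod_unif (by fun_prop) hb2 h0 ⟨h, rfl⟩))
    (integral_mul_prod_unif (by fun_prop) (integral_unit_pow 4) h0 h0)
  rw [fixMap, integral_map measurable_fixFun.aemeasurable (by fun_prop),
    integrable_map_measure (by fun_prop) measurable_fixFun.aemeasurable]
  refine ⟨j.1.congr (ae_of_all _ fun p => ?_),
    (integral_congr_ae (ae_of_all _ fun p => ?_)).trans (j.2.trans ?_)⟩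
  · simp only [Function.comp_apply]
    ring
  · ring
  · push_cast
    ring

end Moments

/-! ### Lévy continuity and existence of a fixpoint -/

open scoped Topology in
/-- **Lévy's continuity theorem**: if the characteristic functions of a sequence of probability
measures converge to a function that is continuous at `0`, then the measures converge weakly. -/
lemma exists_tendsto_of_tendsto_charFun {μ : ℕ → ProbabilityMeasure ℝ} {f : ℝ → ℂ}
    (hf : ContinuousAt f 0) (h : ∀ t, Tendsto (fun n => charFun (μ n : Measure ℝ) t) atTop (𝓝 (f t))) :
    ∃ μ₀ : ProbabilityMeasure ℝ, Tendsto μ atTop (𝓝 μ₀) := by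
  have htight := isTightMeasureSet_of_tendsto_charFun (μ := fun n => (μ n : Measure ℝ)) hf h
  have hcomp : IsCompact (closure (Set.range μ)) :=
    isCompact_closure_of_isTightMeasureSet (htight.subset (by rintro _ ⟨_, ⟨n, rfl⟩, rfl⟩; exact ⟨n, rfl⟩))
  -- Compactness along a free ultrafilter gives a limit point without extracting a subsequence; its
  -- characteristic function must be `f`.
  obtain ⟨μ₀, -, hμ₀⟩ := hcomp.ultrafilter_le_nhds ((Filter.hyperfilter ℕ).map μ)
    (.trans (by simp) (Filter.monotone_principal subset_closure))
  have hT : Tendsto μ (Filter.hyperfilter ℕ : Filter ℕ) (𝓝 μ₀) := hμ₀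
  refine ⟨μ₀, ProbabilityMeasure.tendsto_of_tendsto_charFun fun t => ?_⟩
  rw [ProbabilityMeasure.tendsto_iff_forall_integral_rclike_tendsto ℂ] at hT
  have h1 := hT (BoundedContinuousFunction.innerProbChar t)
  simp only [← charFun_eq_integral_innerProbChar] at h1
  have h2 := (h t).mono_left (Nat.hyperfilter_le_atTop)
  rw [tendsto_nhds_unique h1 h2]
  exact h t

lemma norm_charFun_sub_le {μ : Measure ℝ} [IsProbabilityMeasure μ] (hpos : ∀ᵐ x ∂μ, 0 ≤ x)
    (hint : Integrable (fun x => x) μ) (s t : ℝ) :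
    ‖charFun μ s - charFun μ t‖ ≤ |s - t| * ∫ x, x ∂μ := by
  have hi : ∀ r : ℝ, Integrable (fun x : ℝ => Complex.exp (r * x * Complex.I)) μ := fun r => by
    refine Integrable.of_bound (C := 1) (by fun_prop) (ae_of_all _ fun x => ?_)
    rw [← Complex.ofReal_mul, Complex.norm_exp_ofReal_mul_I]
  rw [charFun_apply_real, charFun_apply_real, ← integral_sub (hi s) (hi t), ← integral_const_mul]
  refine norm_integral_le_of_norm_le (hint.const_mul _) ?_
  filter_upwards [hpos] with x hx
  have e : Complex.exp (s * x * Complex.I) - Complex.exp (t * x * Complex.I)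
      = Complex.exp ((t * x : ℝ) * Complex.I)
        * (Complex.exp (Complex.I * ((s - t) * x : ℝ)) - 1) := by
    rw [mul_sub, ← Complex.exp_add, mul_one]
    congr 2
    · push_cast; ring
    · push_cast; ring
  rw [e, norm_mul, Complex.norm_exp_ofReal_mul_I, one_mul]
  refine Real.norm_exp_I_mul_ofReal_sub_one_le.trans (le_of_eq ?_)
  rw [Real.norm_eq_abs, abs_mul, abs_of_nonneg hx]

lemma norm_charFun_sub_one_le {μ : Measure ℝ} [IsProbabilityMeasure μ] (hpos : ∀ᵐ x ∂μ, 0 ≤ x)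
    (hint : Integrable (fun x => x) μ) (h1 : ∫ x, x ∂μ ≤ 1) (t : ℝ) :
    ‖charFun μ t - 1‖ ≤ |t| := by
  have h := norm_charFun_sub_le hpos hint t 0
  rw [charFun_zero, probReal_univ, sub_zero, Complex.ofReal_one] at h
  exact h.trans (mul_le_of_le_one_right (abs_nonneg t) h1)

/-- The iterates of `fixMap`, starting at the unit mass at `0`. -/
noncomputable def fixIter : ℕ → Measure ℝ
  | 0 => Measure.dirac 0
  | n + 1 => fixMap (fixIter n)

instance isProbabilityMeasure_fixIter (n : ℕ) : IsProbabilityMeasure (fixIter n) := by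
  induction n with
  | zero => rw [fixIter]; infer_instance
  | succ n ih => rw [fixIter]; infer_instance

lemma fixIter_nonneg (n : ℕ) : ∀ᵐ x ∂(fixIter n), 0 ≤ x := by
  induction n with
  | zero => simp [fixIter, ae_dirac_eq]
  | succ n ih => exact fixMap_nonneg ih

/-- The bounds 1 and 11/9 are the fixed values of the two moment recursions, hence preserved by
them. -/
lemma fixIter_moments (n : ℕ) :
    Integrable (fun x => x) (fixIter n) ∧ Integrable (fun x => x ^ 2) (fixIter n) ∧
      ∫ x, x ∂(fixIter n) ≤ 1 ∧ ∫ x, x ^ 2 ∂(fixIter n) ≤ 11 / 9 := by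
  induction n with
  | zero =>
    rw [fixIter]
    exact ⟨integrable_dirac (by simp), integrable_dirac (by simp), by simp, by simp; norm_num⟩
  | succ n ih =>
    obtain ⟨i1, i2, h1, h2⟩ := ih
    have h0 : 0 ≤ ∫ x, x ∂(fixIter n) := integral_nonneg_of_ae (fixIter_nonneg n)
    obtain ⟨j1, k1⟩ := integral_fixMap i1
    obtain ⟨j2, k2⟩ := integral_sq_fixMap i1 i2
    refine ⟨j1, j2, ?_, ?_⟩
    · rw [fixIter, k1]; linarith
    · rw [fixIter, k2]; nlinarith

lemma norm_charFun_fixIter_succ_sub_le (n : ℕ) (t : ℝ) :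
    ‖charFun (fixIter n) t - charFun (fixIter (n + 1)) t‖ ≤ (2 / 3) ^ n * |t| := by
  induction n generalizing t with
  | zero =>
    obtain ⟨i1, -, h1, -⟩ := fixIter_moments 1
    have h := norm_charFun_sub_one_le (fixIter_nonneg 1) i1 h1 t
    have e : charFun (fixIter 0) t = 1 := by simp [fixIter, charFun_dirac]
    rw [e, norm_sub_rev]
    simpa using h
  | succ n ih =>
    refine (norm_charFun_fixMap_sub_le ih t).trans (le_of_eq ?_)
    ring

-- Picard iteration on characteristic functions. Moments are not passed to the limit: weak
-- convergence supplies nonnegativity and a finite second moment, after which the linear moment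
-- equations of the fixpoint give exact values.
open scoped Topology in
lemma exists_fixMap_eq : ∃ μ : Measure ℝ, IsProbabilityMeasure μ ∧ fixMap μ = μ ∧
    (∀ᵐ x ∂μ, 0 ≤ x) ∧ Integrable (fun x => x) μ ∧ Integrable (fun x => x ^ 2) μ ∧
    ∫ x, x ∂μ = 1 ∧ ∫ x, x ^ 2 ∂μ = 11 / 9 := by
  let ρ : ℕ → ProbabilityMeasure ℝ := fun n => ⟨fixIter n, inferInstance⟩
  have hgeo : ∀ t n, dist (charFun (fixIter n) t) (charFun (fixIter (n + 1)) t)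
      ≤ |t| * (2 / 3) ^ n := fun t n => by
    rw [dist_eq_norm, mul_comm]
    exact norm_charFun_fixIter_succ_sub_le n t
  choose ψ hψ using fun t : ℝ => cauchySeq_tendsto_of_complete
    (cauchySeq_of_le_geometric (2 / 3 : ℝ) |t| (by norm_num) (hgeo t))
  have hψ1 : ∀ t, ‖ψ t - 1‖ ≤ |t| := fun t =>
    le_of_tendsto ((hψ t).sub_const 1).norm (Eventually.of_forall fun n =>
      norm_charFun_sub_one_le (fixIter_nonneg n) (fixIter_moments n).1 (fixIter_moments n).2.2.1 t)
  have hψ0 : ψ 0 = 1 := by simpa [sub_eq_zero] using hψ1 0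
  have hcont : ContinuousAt ψ 0 := by
    rw [ContinuousAt, hψ0, tendsto_iff_norm_sub_tendsto_zero]
    exact squeeze_zero (fun _ => norm_nonneg _) hψ1 (by simpa using (continuous_abs.tendsto (0 : ℝ)))
  obtain ⟨μ, hμ⟩ := exists_tendsto_of_tendsto_charFun (μ := ρ) hcont hψ
  have hlim := ProbabilityMeasure.tendsto_iff_tendsto_charFun.1 hμ
  -- The factor 3 is `1 / (1 - 2/3)`, from summing the geometric tail.
  have hrate : ∀ n t, ‖charFun (fixIter n) t - charFun (μ : Measure ℝ) t‖
      ≤ 3 * (2 / 3) ^ n * |t| := fun n t => by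
    rw [← dist_eq_norm]
    refine (dist_le_of_le_geometric_of_tendsto (2 / 3 : ℝ) |t| (by norm_num) (hgeo t) (hlim t)
      n).trans (le_of_eq ?_)
    ring
  have hfix : fixMap (μ : Measure ℝ) = μ := by
    refine Measure.ext_of_charFun (funext fun t => ?_)
    have h1 : Tendsto (fun n => charFun (fixIter (n + 1)) t) atTop
        (𝓝 (charFun (fixMap (μ : Measure ℝ)) t)) := by
      rw [tendsto_iff_norm_sub_tendsto_zero]
      refine squeeze_zero (fun _ => norm_nonneg _)
        (fun n => norm_charFun_fixMap_sub_le (hrate n) t) ?_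
      have := tendsto_pow_atTop_nhds_zero_of_lt_one (r := (2 / 3 : ℝ)) (by norm_num) (by norm_num)
      have := (this.const_mul (2 * |t|))
      rw [mul_zero] at this
      refine this.congr fun n => by ring
    exact tendsto_nhds_unique h1 ((hlim t).comp (tendsto_add_atTop_nat 1))
  -- The portmanteau inequality for open sets yields both nonnegativity (with `G = Iio 0`) and a
  -- Fatou bound on the second moment.
  have hopen : ∀ G : Set ℝ, IsOpen G → (μ : Measure ℝ) G ≤ atTop.liminf fun n => fixIter n G :=
    fun G hG => ProbabilityMeasure.le_liminf_measure_open_of_tendsto hμ hG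
  have hpos : ∀ᵐ x ∂(μ : Measure ℝ), 0 ≤ x := by
    have h0 : ∀ n, fixIter n (Iio 0) = 0 := fun n => by
      have := fixIter_nonneg n
      rw [ae_iff] at this
      simpa [Iio, not_le] using this
    have := hopen (Iio 0) isOpen_Iio
    simp only [h0, liminf_const] at this
    rw [ae_iff]
    simpa [Iio, not_le] using this
  have hL2 : Integrable (fun x : ℝ => x ^ 2) (μ : Measure ℝ) := by
    have h1 := lintegral_le_liminf_lintegral_of_forall_isOpen_measure_le_liminf_measure
      (f := fun x : ℝ => x ^ 2) (by fun_prop) (fun x => sq_nonneg x) hopen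
    have h2 : ∀ n, ∫⁻ x, ENNReal.ofReal (x ^ 2) ∂(fixIter n) ≤ ENNReal.ofReal (11 / 9) := fun n => by
      obtain ⟨-, i2, -, b2⟩ := fixIter_moments n
      rw [← ofReal_integral_eq_lintegral_ofReal i2 (ae_of_all _ fun x => sq_nonneg x)]
      exact ENNReal.ofReal_le_ofReal b2
    have h3 : ∫⁻ x, ENNReal.ofReal (x ^ 2) ∂(μ : Measure ℝ) ≤ ENNReal.ofReal (11 / 9) :=
      h1.trans ((liminf_le_liminf (Eventually.of_forall h2)).trans (by simp))
    refine ⟨by fun_prop, ?_⟩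
    rw [hasFiniteIntegral_iff_ofReal (ae_of_all _ fun x => sq_nonneg x)]
    exact h3.trans_lt ENNReal.ofReal_lt_top
  have hL1 : Integrable (fun x : ℝ => x) (μ : Measure ℝ) :=
    ((memLp_two_iff_integrable_sq (by fun_prop)).2 hL2).integrable (by norm_num)
  have hm1 := (integral_fixMap hL1).2
  have hm2 := (integral_sq_fixMap hL1 hL2).2
  rw [hfix] at hm1 hm2
  have h1 : ∫ x, x ∂(μ : Measure ℝ) = 1 := by linarith
  rw [h1] at hm2
  exact ⟨μ, inferInstance, hfix, hpos, hL1, hL2, h1, by linarith⟩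

/-! ### Convergence of the characteristic functions -/

lemma norm_riemannSum_sub_integral_le {f : ℝ → ℂ} (hf : Continuous f) {K : ℝ}
    (hK : ∀ u ∈ Icc (0 : ℝ) 1, ∀ v ∈ Icc (0 : ℝ) 1, ‖f u - f v‖ ≤ K * |u - v|) (hK0 : 0 ≤ K)
    (n : ℕ) (x : ℕ → ℝ)
    (hx : ∀ k ≤ n, x k ∈ Icc ((k : ℝ) / (n + 1)) ((k + 1 : ℝ) / (n + 1))) :
    ‖(1 / (n + 1 : ℂ)) * ∑ k ∈ Finset.range (n + 1), f (x k) - ∫ v in (0 : ℝ)..1, f v‖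
      ≤ K / (n + 1) := by
  have hn : (0 : ℝ) < n + 1 := by positivity
  have hsum : ∫ v in (0 : ℝ)..1, f v = ∑ k ∈ Finset.range (n + 1),
      ∫ v in ((k : ℝ) / (n + 1))..((k + 1 : ℝ) / (n + 1)), f v := by
    have := intervalIntegral.sum_integral_adjacent_intervals (f := f) (μ := volume)
      (a := fun k : ℕ => (k : ℝ) / (n + 1)) (n := n + 1) fun k _ => hf.intervalIntegrable _ _
    push_cast at this
    rw [this, zero_div, div_self hn.ne']
  have hlen : ∀ k : ℕ, ((k + 1 : ℝ) / (n + 1)) - (k : ℝ) / (n + 1) = 1 / (n + 1) := fun k => by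
    field_simp; ring
  have hterm : ∀ k ∈ Finset.range (n + 1), ‖(1 / (n + 1 : ℂ)) * f (x k)
      - ∫ v in ((k : ℝ) / (n + 1))..((k + 1 : ℝ) / (n + 1)), f v‖ ≤ K / (n + 1) * (1 / (n + 1)) := by
    intro k hk
    have hkn : k ≤ n := Nat.lt_succ_iff.1 (Finset.mem_range.1 hk)
    have hkn' : (k : ℝ) ≤ n := by exact_mod_cast hkn
    have hxk := hx k hkn
    have hle : (k : ℝ) / (n + 1) ≤ (k + 1 : ℝ) / (n + 1) := by gcongr; linarith
    have h0 : 0 ≤ (k : ℝ) / (n + 1) := by positivity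
    have h1 : (k + 1 : ℝ) / (n + 1) ≤ 1 := by rw [div_le_one hn]; linarith
    have hc : (1 / (n + 1 : ℂ)) * f (x k)
        = ∫ v in ((k : ℝ) / (n + 1))..((k + 1 : ℝ) / (n + 1)), f (x k) := by
      rw [intervalIntegral.integral_const, hlen, Complex.real_smul]
      push_cast
      ring
    rw [hc, ← intervalIntegral.integral_sub intervalIntegrable_const (hf.intervalIntegrable _ _)]
    have := intervalIntegral.norm_integral_le_of_norm_le_const
      (a := (k : ℝ) / (n + 1)) (b := (k + 1 : ℝ) / (n + 1)) (f := fun v => f (x k) - f v)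
      (C := K / (n + 1)) fun v hv => by
        rw [uIoc_of_le hle] at hv
        refine (hK _ ⟨h0.trans hxk.1, hxk.2.trans h1⟩ _ ⟨h0.trans hv.1.le, hv.2.trans h1⟩).trans ?_
        rw [div_eq_mul_one_div]
        refine mul_le_mul_of_nonneg_left ?_ hK0
        rw [← hlen k, abs_le]
        constructor <;> linarith [hxk.1, hxk.2, hv.1, hv.2]
    rwa [hlen, abs_of_nonneg (by positivity)] at this
  rw [hsum, Finset.mul_sum, ← Finset.sum_sub_distrib]
  refine (norm_sum_le_of_le _ hterm).trans (le_of_eq ?_)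
  rw [Finset.sum_const, Finset.card_range, nsmul_eq_mul]
  push_cast
  field_simp

/-- A sequence that grows like `24 log n`. -/
noncomputable def logBound (n : ℕ) : ℝ := 1 + 24 * ∑ i ∈ Finset.range n, 1 / ((i : ℝ) + 2)

lemma logBound_succ (n : ℕ) : logBound (n + 1) = logBound n + 24 / ((n : ℝ) + 2) := by
  rw [logBound, logBound, Finset.sum_range_succ]; ring

/-- This is the inequality that closes the induction in `norm_treeCharFun_sub_le`. The 6 is the
Lipschitz constant of the Riemann sum there, and 24 makes the case `n = 0` an equality. -/
lemma sum_logBound_le (n : ℕ) :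
    2 * ∑ k ∈ Finset.range (n + 1), ((k : ℝ) + 1) * logBound k + 6 * ((n : ℝ) + 2) ^ 2
      ≤ (n + 1) * ((n + 2) * logBound (n + 1)) := by
  induction n with
  | zero => simp [logBound]; norm_num
  | succ n ih =>
    rw [Finset.sum_range_succ, logBound_succ (n + 1)]
    push_cast
    have h : ((n : ℝ) + 1 + 2) * (24 / ((n : ℝ) + 1 + 2)) = 24 := by field_simp
    have e : ((n : ℝ) + 1 + 1) * ((n + 1 + 2) * (logBound (n + 1) + 24 / ((n : ℝ) + 1 + 2)))
        = (n + 2) * (n + 3) * logBound (n + 1)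
          + (n + 2) * (((n : ℝ) + 1 + 2) * (24 / ((n : ℝ) + 1 + 2))) := by ring
    rw [e, h]
    nlinarith [(Nat.cast_nonneg n : (0 : ℝ) ≤ n)]

open scoped Topology in
lemma tendsto_logBound_div : Tendsto (fun n : ℕ => logBound n / ((n : ℝ) + 1)) atTop (𝓝 0) := by
  have h1 : Tendsto (fun n : ℕ => 1 / ((n : ℝ) + 1)) atTop (𝓝 0) :=
    tendsto_one_div_add_atTop_nhds_zero_nat
  have h2 : Tendsto (fun n : ℕ => 1 / ((n : ℝ) + 2)) atTop (𝓝 0) := by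
    have := h1.comp (tendsto_add_atTop_nat 1)
    refine this.congr fun n => ?_
    simp only [Function.comp_apply]
    push_cast
    ring
  -- `logBound n / n` is essentially a Cesàro mean of a null sequence.
  have h3 := h1.add (h2.cesaro.const_mul 24)
  rw [mul_zero, add_zero] at h3
  refine squeeze_zero (fun n => ?_) (fun n => ?_) h3
  · rw [logBound]; positivity
  · rw [logBound, add_div, mul_div_assoc]
    gcongr
    rw [div_eq_inv_mul]
    rcases Nat.eq_zero_or_pos n with rfl | hn
    · simp
    · gcongr
      linarith

lemma norm_exp_sub_exp_le (s t : ℝ) :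
    ‖Complex.exp (s * Complex.I) - Complex.exp (t * Complex.I)‖ ≤ |s - t| := by
  have e : Complex.exp (s * Complex.I) - Complex.exp (t * Complex.I)
      = Complex.exp (t * Complex.I) * (Complex.exp (Complex.I * (s - t : ℝ)) - 1) := by
    rw [mul_sub, ← Complex.exp_add, mul_one]
    congr 2
    push_cast; ring
  rw [e, norm_mul, Complex.norm_exp_ofReal_mul_I, one_mul]
  exact Real.norm_exp_I_mul_ofReal_sub_one_le

/-- Strong induction: the error splits into the averaged errors of the two subtrees and a Riemann
sum error of order `1/n`. At rate `1/n` the averaging gains nothing, since `2 ∑ (k + 1) / (n + 2)²`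
is asymptotically 1, so the Riemann errors accumulate harmonically and cost a logarithm. -/
lemma norm_treeCharFun_sub_le {μ : Measure ℝ} [IsProbabilityMeasure μ] (hfix : fixMap μ = μ)
    (hpos : ∀ᵐ x ∂μ, 0 ≤ x) (hint : Integrable (fun x => x) μ) (h1 : ∫ x, x ∂μ = 1)
    (n : ℕ) (t : ℝ) :
    ‖treeCharFun n (t / ((n : ℝ) + 1) ^ 2) - charFun μ t‖ ≤ logBound n / (n + 1) * |t| := by
  have hLip : ∀ s r : ℝ, ‖charFun μ s - charFun μ r‖ ≤ |s - r| := fun s r => by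
    simpa [h1] using norm_charFun_sub_le hpos hint s r
  induction n using Nat.strong_induction_on generalizing t with
  | _ n ih =>
  rcases n with _ | n
  · have := norm_charFun_sub_one_le hpos hint h1.le t
    rw [treeCharFun_zero, norm_sub_rev]
    simpa [logBound] using this
  let f : ℝ → ℂ := fun v => Complex.exp ((t * v ^ 2 : ℝ) * Complex.I)
    * (charFun μ (t * v ^ 2) * charFun μ (t * (1 - v) ^ 2))
  have hμc : Continuous (charFun μ) := continuous_charFun
  have hf : Continuous f := by fun_prop
  have hI : charFun μ t = ∫ v in (0 : ℝ)..1, f v := by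
    rw [← hfix, charFun_fixMap, integral_unif_eq]
    refine intervalIntegral.integral_congr fun v _ => ?_
    simp only [f]
    congr 2
    push_cast
    ring
  -- Each of the three factors of `f` is bounded by 1 and has Lipschitz constant `2 |t|`.
  have hK : ∀ u ∈ Icc (0 : ℝ) 1, ∀ v ∈ Icc (0 : ℝ) 1, ‖f u - f v‖ ≤ 6 * |t| * |u - v| := by
    intro u hu v hv
    have hsq : ∀ a ∈ Icc (0 : ℝ) 1, ∀ b ∈ Icc (0 : ℝ) 1,
        |t * a ^ 2 - t * b ^ 2| ≤ 2 * |t| * |a - b| := by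
      intro a ha b hb
      have : t * a ^ 2 - t * b ^ 2 = (a + b) * (t * (a - b)) := by ring
      rw [this, abs_mul, abs_mul, mul_assoc]
      refine mul_le_mul_of_nonneg_right ?_ (by positivity)
      rw [abs_of_nonneg (by linarith [ha.1, hb.1])]
      linarith [ha.2, hb.2]
    have b1 := (norm_exp_sub_exp_le (t * u ^ 2) (t * v ^ 2)).trans (hsq u hu v hv)
    have b2 := (hLip (t * u ^ 2) (t * v ^ 2)).trans (hsq u hu v hv)
    have b3 := (hLip (t * (1 - u) ^ 2) (t * (1 - v) ^ 2)).trans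
      (hsq (1 - u) ⟨by linarith [hu.2], by linarith [hu.1]⟩ (1 - v)
        ⟨by linarith [hv.2], by linarith [hv.1]⟩)
    rw [show (1 - u) - (1 - v) = -(u - v) by ring, abs_neg] at b3
    have c1 := norm_mul_sub_mul_le (a := charFun μ (t * u ^ 2)) (a' := charFun μ (t * v ^ 2))
      (b := charFun μ (t * (1 - u) ^ 2)) (b' := charFun μ (t * (1 - v) ^ 2))
      (norm_charFun_le_one _) (norm_charFun_le_one _)
    have c2 := norm_mul_sub_mul_le (a := Complex.exp ((t * u ^ 2 : ℝ) * Complex.I))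
      (a' := Complex.exp ((t * v ^ 2 : ℝ) * Complex.I))
      (b := charFun μ (t * u ^ 2) * charFun μ (t * (1 - u) ^ 2))
      (b' := charFun μ (t * v ^ 2) * charFun μ (t * (1 - v) ^ 2))
      (Complex.norm_exp_ofReal_mul_I _).le (by
        rw [norm_mul]
        exact mul_le_one₀ (norm_charFun_le_one _) (norm_nonneg _) (norm_charFun_le_one _))
    linarith
  have hn2 : (0 : ℝ) < n + 2 := by positivity
  have hn1 : (0 : ℝ) < n + 1 := by positivity
  -- The ratio `(k + 1) / (n + 2)` of subtree size to tree size lies in the `k`-th of `n + 1` equal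
  -- cells.
  have hR := norm_riemannSum_sub_integral_le hf hK (by positivity) n
    (fun k => ((k : ℝ) + 1) / (n + 2)) fun k hk => by
      have hk' : (k : ℝ) ≤ n := by exact_mod_cast hk
      constructor
      · rw [div_le_div_iff₀ hn1 hn2]; nlinarith
      · exact div_le_div_of_nonneg_left (by positivity) hn1 (by linarith)
  -- The induction hypothesis at the rescaled argument: the square of the size ratio absorbs the
  -- divisor `m + 1` and leaves a factor `m + 1`.
  have hrec : ∀ m ≤ n, ‖treeCharFun m (t / ((n : ℝ) + 2) ^ 2)
      - charFun μ (t * (((m : ℝ) + 1) / (n + 2)) ^ 2)‖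
      ≤ ((m : ℝ) + 1) * logBound m * (|t| / ((n : ℝ) + 2) ^ 2) := by
    intro m hm
    have hm1 : (0 : ℝ) < m + 1 := by positivity
    have := ih m (by omega) (t * (((m : ℝ) + 1) / (n + 2)) ^ 2)
    rw [abs_mul, abs_of_nonneg (sq_nonneg (((m : ℝ) + 1) / (n + 2)))] at this
    convert this using 1
    · congr 3
      field_simp
    · field_simp
  have hterm : ∀ k ∈ Finset.range (n + 1),
      ‖Complex.exp ((t / ((n : ℝ) + 2) ^ 2 : ℝ) * Complex.I * (k + 1 : ℝ) ^ 2)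
        * (treeCharFun k (t / ((n : ℝ) + 2) ^ 2) * treeCharFun (n - k) (t / ((n : ℝ) + 2) ^ 2))
        - f (((k : ℝ) + 1) / (n + 2))‖
      ≤ (((k : ℝ) + 1) * logBound k + (((n - k : ℕ) : ℝ) + 1) * logBound (n - k))
        * (|t| / ((n : ℝ) + 2) ^ 2) := by
    intro k hk
    have hkn : k ≤ n := Nat.lt_succ_iff.1 (Finset.mem_range.1 hk)
    have e1 : Complex.exp ((t / ((n : ℝ) + 2) ^ 2 : ℝ) * Complex.I * (k + 1 : ℝ) ^ 2)
        = Complex.exp ((t * (((k : ℝ) + 1) / (n + 2)) ^ 2 : ℝ) * Complex.I) := by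
      congr 1
      push_cast
      rw [div_pow]
      ring
    have e2 : (1 : ℝ) - ((k : ℝ) + 1) / (n + 2) = (((n - k : ℕ) : ℝ) + 1) / (n + 2) := by
      rw [Nat.cast_sub hkn]
      field_simp
      ring
    simp only [f]
    rw [e1, ← mul_sub, norm_mul, Complex.norm_exp_ofReal_mul_I, one_mul, e2, add_mul]
    exact (norm_mul_sub_mul_le (norm_charFun_le_one _) (norm_treeCharFun_le_one _ _)).trans
      (add_le_add (hrec k hkn) (hrec (n - k) (Nat.sub_le n k)))
  have hS : ‖treeCharFun (n + 1) (t / ((n : ℝ) + 2) ^ 2) - (1 / (n + 1 : ℂ))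
        * ∑ k ∈ Finset.range (n + 1), f (((k : ℝ) + 1) / (n + 2))‖
      ≤ 1 / (n + 1) * (2 * (∑ k ∈ Finset.range (n + 1), ((k : ℝ) + 1) * logBound k)
        * (|t| / ((n : ℝ) + 2) ^ 2)) := by
    rw [treeCharFun_succ, ← mul_sub, ← Finset.sum_sub_distrib, norm_mul]
    have hn : ‖(1 / (n + 1 : ℂ))‖ = 1 / (n + 1 : ℝ) := by
      rw [norm_div, norm_one]
      congr 1
      exact_mod_cast Complex.norm_natCast (n + 1)
    rw [hn]
    refine mul_le_mul_of_nonneg_left ((norm_sum_le_of_le _ hterm).trans (le_of_eq ?_))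
      (by positivity)
    rw [← Finset.sum_mul, Finset.sum_add_distrib]
    have := Finset.sum_range_reflect (fun k : ℕ => ((k : ℝ) + 1) * logBound k) (n + 1)
    simp only [Nat.add_sub_cancel] at this
    rw [this]
    ring
  have hfinal := norm_sub_le_norm_sub_add_norm_sub (treeCharFun (n + 1) (t / ((n : ℝ) + 2) ^ 2))
    ((1 / (n + 1 : ℂ)) * ∑ k ∈ Finset.range (n + 1), f (((k : ℝ) + 1) / (n + 2))) (charFun μ t)
  rw [hI] at hfinal ⊢
  have e3 : ((n + 1 : ℕ) : ℝ) + 1 = n + 2 := by push_cast; ring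
  rw [e3]
  refine hfinal.trans ((add_le_add hS hR).trans ?_)
  have hb := mul_le_mul_of_nonneg_right (sum_logBound_le n)
    (show 0 ≤ |t| / ((n + 1) * ((n : ℝ) + 2) ^ 2) by positivity)
  refine le_trans (le_of_eq ?_) (hb.trans (le_of_eq ?_)) <;> field_simp

open scoped Topology in
lemma tendsto_treeCharFun {μ : Measure ℝ} [IsProbabilityMeasure μ] (hfix : fixMap μ = μ)
    (hpos : ∀ᵐ x ∂μ, 0 ≤ x) (hint : Integrable (fun x => x) μ) (h1 : ∫ x, x ∂μ = 1) (t : ℝ) :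
    Tendsto (fun n : ℕ => treeCharFun n (t / ((n : ℝ) + 1) ^ 2)) atTop (𝓝 (charFun μ t)) := by
  rw [tendsto_iff_norm_sub_tendsto_zero]
  refine squeeze_zero (fun _ => norm_nonneg _)
    (fun n => norm_treeCharFun_sub_le hfix hpos hint h1 n t) ?_
  simpa using tendsto_logBound_div.mul_const |t|

/-! ### Normal jumps -/

instance (v : ℝ≥0) : IsMarkovKernel (normalKernel v) :=
  ⟨fun x => inferInstanceAs (IsProbabilityMeasure (gaussianReal x v))⟩

instance : IsMarkovKernel centredNormalKernel :=
  ⟨fun x => inferInstanceAs (IsProbabilityMeasure (gaussianReal 0 x.toNNReal))⟩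

/-- The σ-algebra generated by `J_1, J_2, …`. -/
abbrev treeSigma {Ω : Type*} (J : ℕ → Ω → ℕ) : MeasurableSpace Ω :=
  ⨆ k : ℕ, MeasurableSpace.comap (J (k + 1)) inferInstance

lemma measurable_treeSigma {Ω : Type*} (J : ℕ → Ω → ℕ) {k : ℕ} (hk : 1 ≤ k) :
    Measurable[treeSigma J] (J k) := by
  obtain ⟨k, rfl⟩ := Nat.exists_eq_add_of_le' hk
  exact (comap_measurable (J (k + 1))).mono
    (le_iSup (fun k : ℕ => MeasurableSpace.comap (J (k + 1)) inferInstance) k) le_rfl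

lemma measurable_history {Ω : Type*} (J : ℕ → Ω → ℕ) (X : ℕ → Ω → ℝ) (n : ℕ) {k : ℕ}
    (hk : k < n) : Measurable[history J X n] (X k) :=
  (comap_measurable (X k)).mono (le_sup_of_le_left
    (le_iSup (fun i : Fin n => MeasurableSpace.comap (X i) inferInstance) ⟨k, hk⟩)) le_rfl

namespace IsRecursiveSet

variable {Ω : Type*} [mΩ : MeasurableSpace Ω] {P : Measure Ω} {J : ℕ → Ω → ℕ}
  {X : ℕ → Ω → ℝ} {θ : ℝ} {κ : Kernel ℝ ℝ}

lemma treeSigma_le (h : IsRecursiveSet θ κ J X P) : treeSigma J ≤ mΩ :=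
  iSup_le fun k => (h.hoppe.measurable (k + 1) (by omega)).comap_le

lemma history_le (h : IsRecursiveSet θ κ J X P) (n : ℕ) : history J X n ≤ mΩ :=
  sup_le (iSup_le fun i => (h.measurable i).comap_le) h.treeSigma_le

/-- The joint distribution of `X_n` and the past. -/
lemma map_eq_compProd [IsProbabilityMeasure P] [IsMarkovKernel κ] (h : IsRecursiveSet θ κ J X P)
    {n : ℕ} (hn : 1 ≤ n) {β : Type*} [MeasurableSpace β] {Y : Ω → β}
    (hY : Measurable[history J X n] Y) {D : Ω → ℝ} (hD : Measurable[history J X n] D)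
    (hDX : D =ᵐ[P] fun ω => X (J n ω) ω) :
    P.map (fun ω => ((Y ω, D ω), X n ω)) = P.map (fun ω => (Y ω, D ω)) ⊗ₘ κ.prodMkLeft β := by
  have hle := h.history_le n
  have hYD : Measurable[history J X n] fun ω => (Y ω, D ω) := hY.prodMk hD
  have hYD' : Measurable fun ω => (Y ω, D ω) := hYD.mono hle le_rfl
  have : IsProbabilityMeasure (P.map fun ω => ((Y ω, D ω), X n ω)) :=
    Measure.isProbabilityMeasure_map (hYD'.prodMk (h.measurable n)).aemeasurable
  refine Measure.ext_prod fun {C B} hC hB => ?_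
  have hS : MeasurableSet[history J X n] ((fun ω => (Y ω, D ω)) ⁻¹' C) := hYD hC
  have hXB : MeasurableSet (X n ⁻¹' B) := h.measurable n hB
  have hκ : Measurable fun ω => κ (D ω) B :=
    (Kernel.measurable_coe κ hB).comp (hD.mono hle le_rfl)
  -- The two laws are compared on rectangles, where the defining property of conditional expectation
  -- applies.
  have h1 := setIntegral_condExp hle ((integrable_const (μ := P) (1 : ℝ)).indicator hXB) hS
  rw [setIntegral_indicator hXB, setIntegral_const, smul_eq_mul, mul_one] at h1
  have h2 : ∫ ω in (fun ω => (Y ω, D ω)) ⁻¹' C, (P⟦X n ⁻¹' B|history J X n⟧) ω ∂P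
      = ∫ ω in (fun ω => (Y ω, D ω)) ⁻¹' C, (κ (D ω)).real B ∂P := by
    refine integral_congr_ae (ae_restrict_of_ae ?_)
    filter_upwards [h.jump n hn B hB, hDX] with ω hω hω'
    rw [hω, hω']
  have h3 : ∫ ω in (fun ω => (Y ω, D ω)) ⁻¹' C, (κ (D ω)).real B ∂P
      = (∫⁻ ω in (fun ω => (Y ω, D ω)) ⁻¹' C, κ (D ω) B ∂P).toReal :=
    integral_toReal hκ.aemeasurable (ae_of_all _ fun ω => measure_lt_top _ _)
  rw [Measure.map_apply (hYD'.prodMk (h.measurable n)) (hC.prod hB),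
    Measure.compProd_apply_prod hC hB, setLIntegral_map hC
      (Kernel.measurable_coe _ hB) hYD']
  have h4 : ∫⁻ ω in (fun ω => (Y ω, D ω)) ⁻¹' C, κ (D ω) B ∂P ≠ ∞ := by
    refine ((lintegral_mono fun ω => prob_le_one (μ := κ (D ω))).trans_lt ?_).ne
    simp
  refine (ENNReal.toReal_eq_toReal_iff' (measure_ne_top _ _) h4).1 ?_
  rw [← h3, ← h2, h1]
  rfl

/-- Integrating out `X_n` given the past replaces its exponential by the characteristic function of
`N(D, v)` at `a`. -/
lemma integral_mul_exp [IsProbabilityMeasure P] {v : ℝ≥0}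
    (h : IsRecursiveSet θ (normalKernel v) J X P)
    {n : ℕ} (hn : 1 ≤ n) {W : Ω → ℂ} (hW : Measurable[history J X n] W) (hW1 : ∀ ω, ‖W ω‖ ≤ 1)
    {a : Ω → ℝ} (ha : Measurable[history J X n] a)
    {D : Ω → ℝ} (hD : Measurable[history J X n] D) (hDX : D =ᵐ[P] fun ω => X (J n ω) ω) :
    ∫ ω, W ω * Complex.exp (a ω * X n ω * Complex.I) ∂P
      = ∫ ω, W ω * Complex.exp (a ω * D ω * Complex.I - v * a ω ^ 2 / 2) ∂P := by
  have hle := h.history_le n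
  have hmap := h.map_eq_compProd hn (hW.prodMk ha) hD hDX
  have hWa : Measurable fun ω => ((W ω, a ω), D ω) :=
    ((hW.prodMk ha).prodMk hD).mono hle le_rfl
  have hbd : ∀ x : (ℂ × ℝ) × ℝ, ‖(if ‖x.1.1‖ ≤ 1 then x.1.1 else 0)‖ ≤ 1 := fun x => by
    split_ifs with hx
    · exact hx
    · simp
  -- The truncation makes `F` bounded everywhere; it is invisible on the range of `W`.
  let F : ((ℂ × ℝ) × ℝ) × ℝ → ℂ := fun x =>
    (if ‖x.1.1.1‖ ≤ 1 then x.1.1.1 else 0) * Complex.exp (x.1.1.2 * x.2 * Complex.I)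
  have hF : Measurable F := by
    refine Measurable.mul (Measurable.ite ?_ (by fun_prop) measurable_const) (by fun_prop)
    exact measurableSet_le (by fun_prop) measurable_const
  have hFint : Integrable F (P.map (fun ω => ((W ω, a ω), D ω))
      ⊗ₘ (normalKernel v).prodMkLeft (ℂ × ℝ)) := by
    have : IsProbabilityMeasure (P.map fun ω => ((W ω, a ω), D ω)) :=
      Measure.isProbabilityMeasure_map hWa.aemeasurable
    refine Integrable.of_bound (C := 1) hF.aestronglyMeasurable (ae_of_all _ fun x => ?_)
    rw [norm_mul, ← Complex.ofReal_mul, Complex.norm_exp_ofReal_mul_I, mul_one]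
    exact hbd x.1
  have h1 : ∫ ω, W ω * Complex.exp (a ω * X n ω * Complex.I) ∂P
      = ∫ x, F x ∂(P.map fun ω => (((W ω, a ω), D ω), X n ω)) := by
    rw [integral_map (hWa.prodMk (h.measurable n)).aemeasurable hF.aestronglyMeasurable]
    exact integral_congr_ae (ae_of_all _ fun ω => by simp [F, hW1 ω])
  rw [h1, hmap, Measure.integral_compProd hFint, integral_map hWa.aemeasurable]
  · refine integral_congr_ae (ae_of_all _ fun ω => ?_)
    simp only [F, hW1 ω, if_true]
    rw [integral_const_mul]
    congr 1
    have := charFun_gaussianReal (μ := D ω) (v := v) (a ω)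
    rw [charFun_apply_real] at this
    exact this
  · exact hF.stronglyMeasurable.integral_kernel_prod_right'.aestronglyMeasurable

/-- Integrating out the last point gives the factor `exp (-v A² / 2)` and moves its weight `A` to
its parent, which is exactly the recursion of `subtreeSq`. The factor `G` collects these
contributions, and the weights must be random because the parent is. -/
lemma integral_mul_exp_sum [IsProbabilityMeasure P] {v : ℝ≥0}
    (h : IsRecursiveSet 1 (normalKernel v) J X P) (n : ℕ) {A : Ω → ℕ → ℝ}
    (hA : ∀ p, Measurable[treeSigma J] fun ω => A ω p) {G : Ω → ℂ} (hG : Measurable[treeSigma J] G)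
    (hG1 : ∀ ω, ‖G ω‖ ≤ 1) :
    ∫ ω, G ω * Complex.exp ((∑ k ∈ Finset.range (n + 1), A ω k * X k ω : ℝ) * Complex.I) ∂P
      = ∫ ω, G ω * Complex.exp (-(v * subtreeSq (fun k => J k ω) n (A ω) / 2)) ∂P := by
  induction n generalizing A G with
  | zero =>
    refine integral_congr_ae ?_
    filter_upwards [h.start] with ω hω
    simp [hω, subtreeSq]
  | succ n ih =>
    have hJ : Measurable[treeSigma J] (J (n + 1)) := measurable_treeSigma J (by omega)
    have hJs : ∀ p, MeasurableSet[treeSigma J] {ω | p = J (n + 1) ω} := fun p => by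
      have e : {ω | p = J (n + 1) ω} = J (n + 1) ⁻¹' {p} := by ext ω; simp [eq_comm]
      rw [e]
      exact hJ (measurableSet_singleton p)
    have hJA : ∀ p, Measurable[treeSigma J] fun ω => if p = J (n + 1) ω then A ω (n + 1) else 0 :=
      fun p => Measurable.ite (hJs p) (hA _) measurable_const
    have hle : treeSigma J ≤ history J X (n + 1) := le_sup_right
    -- A version of the parent's position that is visibly measurable for the history; it agrees with
    -- it only where `J (n + 1) ≤ n`, that is, almost surely.
    let D : Ω → ℝ := fun ω => ∑ p ∈ Finset.range (n + 1), if p = J (n + 1) ω then X p ω else 0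
    have hD : Measurable[history J X (n + 1)] D := by
      refine Finset.measurable_fun_sum _ fun p hp => Measurable.ite ?_
        (measurable_history J X _ (Finset.mem_range.1 hp)) measurable_const
      exact hle _ (hJs p)
    have hDX : D =ᵐ[P] fun ω => X (J (n + 1) ω) ω := by
      filter_upwards [h.hoppe.ae_lt] with ω hω
      simp only [D]
      rw [Finset.sum_ite_eq', if_pos (Finset.mem_range.2 (hω _ (by omega)))]
    have hsum : Measurable[history J X (n + 1)] fun ω =>
        ∑ k ∈ Finset.range (n + 1), A ω k * X k ω :=
      Finset.measurable_fun_sum _ fun p hp =>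
        ((hA p).mono hle le_rfl).mul (measurable_history J X _ (Finset.mem_range.1 hp))
    have hW : Measurable[history J X (n + 1)] fun ω => G ω *
        Complex.exp ((∑ k ∈ Finset.range (n + 1), A ω k * X k ω : ℝ) * Complex.I) :=
      (hG.mono hle le_rfl).mul (Measurable.comp (g := fun x : ℝ => Complex.exp (x * Complex.I))
        (by fun_prop) hsum)
    have hW1 : ∀ ω, ‖G ω *
        Complex.exp ((∑ k ∈ Finset.range (n + 1), A ω k * X k ω : ℝ) * Complex.I)‖ ≤ 1 := fun ω => by
      rw [norm_mul, Complex.norm_exp_ofReal_mul_I, mul_one]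
      exact hG1 ω
    have hstep := h.integral_mul_exp (n := n + 1) (by omega) hW hW1 ((hA (n + 1)).mono hle le_rfl)
      hD hDX
    have hG' : Measurable[treeSigma J] fun ω =>
        G ω * Complex.exp (-(v * (A ω (n + 1) : ℂ) ^ 2 / 2)) :=
      hG.mul (Measurable.comp (g := fun x : ℝ => Complex.exp (-(v * (x : ℂ) ^ 2 / 2)))
        (by fun_prop) (hA (n + 1)))
    have hG1' : ∀ ω, ‖G ω * Complex.exp (-(v * (A ω (n + 1) : ℂ) ^ 2 / 2))‖ ≤ 1 := fun ω => by
      have e : (-(v * (A ω (n + 1) : ℂ) ^ 2 / 2)) = ((-(v * (A ω (n + 1)) ^ 2 / 2) : ℝ) : ℂ) := by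
        push_cast; rfl
      rw [norm_mul, e, Complex.norm_exp_ofReal]
      refine mul_le_one₀ (hG1 ω) (Real.exp_nonneg _) (Real.exp_le_one_iff.2 ?_)
      have : 0 ≤ (v : ℝ) * A ω (n + 1) ^ 2 / 2 := by positivity
      linarith
    have hih := ih (A := fun ω p => A ω p + if p = J (n + 1) ω then A ω (n + 1) else 0)
      (fun p => (hA p).add (hJA p)) hG' hG1'
    calc ∫ ω, G ω * Complex.exp
          ((∑ k ∈ Finset.range (n + 1 + 1), A ω k * X k ω : ℝ) * Complex.I) ∂P
        = ∫ ω, G ω * Complex.exp ((∑ k ∈ Finset.range (n + 1), A ω k * X k ω : ℝ) * Complex.I)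
            * Complex.exp (A ω (n + 1) * X (n + 1) ω * Complex.I) ∂P := by
          refine integral_congr_ae (ae_of_all _ fun ω => ?_)
          simp only
          rw [mul_assoc, ← Complex.exp_add, Finset.sum_range_succ _ (n + 1)]
          congr 2
          push_cast
          ring
      _ = _ := hstep
      _ = ∫ ω, G ω * Complex.exp (-(v * (A ω (n + 1) : ℂ) ^ 2 / 2)) * Complex.exp
            ((∑ k ∈ Finset.range (n + 1), (A ω k + if k = J (n + 1) ω then A ω (n + 1) else 0)
              * X k ω : ℝ) * Complex.I) ∂P := by
          refine integral_congr_ae (ae_of_all _ fun ω => ?_)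
          simp only [D]
          rw [mul_assoc (G ω), mul_assoc (G ω), ← Complex.exp_add, ← Complex.exp_add]
          congr 2
          have e : ∑ k ∈ Finset.range (n + 1), (A ω k + if k = J (n + 1) ω then A ω (n + 1) else 0)
              * X k ω = ∑ k ∈ Finset.range (n + 1), A ω k * X k ω + A ω (n + 1)
              * ∑ k ∈ Finset.range (n + 1), if k = J (n + 1) ω then X k ω else 0 := by
            rw [Finset.mul_sum, ← Finset.sum_add_distrib]
            refine Finset.sum_congr rfl fun k _ => ?_
            split_ifs <;> ring
          rw [e, Complex.ofReal_add, Complex.ofReal_mul]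
          ring
      _ = _ := hih
      _ = _ := by
          refine integral_congr_ae (ae_of_all _ fun ω => ?_)
          simp only [subtreeSq]
          rw [mul_assoc, ← Complex.exp_add]
          congr 2
          push_cast
          ring

end IsRecursiveSet

/-! ### Convergence in distribution -/

open scoped Topology in
lemma tendstoInDistribution_of_tendsto_charFun {Ω Ω' : Type*} [MeasurableSpace Ω]
    [MeasurableSpace Ω'] {P : Measure Ω} [IsProbabilityMeasure P] {P' : Measure Ω'}
    [IsProbabilityMeasure P'] {Y : ℕ → Ω → ℝ} {Z : Ω' → ℝ} (hY : ∀ n, AEMeasurable (Y n) P)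
    (hZ : AEMeasurable Z P')
    (h : ∀ t, Tendsto (fun n => charFun (P.map (Y n)) t) atTop (𝓝 (charFun (P'.map Z) t))) :
    TendstoInDistribution Y atTop Z (fun _ => P) P' where
  forall_aemeasurable := hY
  aemeasurable_limit := hZ
  tendsto := ProbabilityMeasure.tendsto_of_tendsto_charFun h

namespace IsHoppeSequence

variable {Ω : Type*} [MeasurableSpace Ω] {P : Measure Ω} [IsProbabilityMeasure P] {J : ℕ → Ω → ℕ}

lemma treeU_ae_eq (h : IsHoppeSequence 1 J P) (n : ℕ) :
    (fun ω => (treeU (fun k => J k ω) (n + 1) : ℝ))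
      =ᵐ[P] fun ω => subtreeSq (fun k => J k ω) n fun _ => 1 := by
  filter_upwards [h.ae_lt] with ω hω
  exact treeU_succ_eq_subtreeSq hω n

lemma aemeasurable_treeU (h : IsHoppeSequence 1 J P) (n : ℕ) :
    AEMeasurable (fun ω => (treeU (fun k => J k ω) n : ℝ)) P := by
  cases n with
  | zero => simp [treeU, totalLength, pairSum]
  | succ n =>
    exact (measurable_subtreeSq h.measurable n fun _ => measurable_const).aemeasurable.congr
      (h.treeU_ae_eq n).symm

lemma tendstoInDistribution_treeU (h : IsHoppeSequence 1 J P) {μ : Measure ℝ}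
    [IsProbabilityMeasure μ] (hfix : fixMap μ = μ) (hpos : ∀ᵐ x ∂μ, 0 ≤ x)
    (hint : Integrable (fun x => x) μ) (h1 : ∫ x, x ∂μ = 1) {Ω' : Type*} [MeasurableSpace Ω']
    {P' : Measure Ω'} [IsProbabilityMeasure P'] {U : Ω' → ℝ} (hU : HasLaw U μ P') :
    TendstoInDistribution (fun (n : ℕ) ω => (treeU (fun k => J k ω) n : ℝ) / (n : ℝ) ^ 2) atTop U
      (fun _ => P) P' := by
  have hm : ∀ n : ℕ, AEMeasurable (fun ω => (treeU (fun k => J k ω) n : ℝ) / (n : ℝ) ^ 2) P :=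
    fun n => (h.aemeasurable_treeU n).div_const _
  refine tendstoInDistribution_of_tendsto_charFun hm hU.aemeasurable fun t => ?_
  rw [hU.map_eq]
  refine (tendsto_add_atTop_iff_nat 1).1 ((tendsto_treeCharFun hfix hpos hint h1 t).congr fun n => ?_)
  rw [charFun_apply_real, integral_map (hm _) (by fun_prop), ← h.integral_exp_treeU]
  refine integral_congr_ae ?_
  filter_upwards [h.treeU_ae_eq n] with ω hω
  rw [hω]
  congr 1
  push_cast
  ring

end IsHoppeSequence

/-- The maximum reflects the truncation of negative variances in `centredNormalKernel`. -/
lemma charFun_mixedCentredNormal (ρ : Measure ℝ) [IsProbabilityMeasure ρ] (t : ℝ) :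
    charFun (mixedCentredNormal ρ) t
      = ∫ x, ((Real.exp (-(t ^ 2 / 2 * max x 0)) : ℝ) : ℂ) ∂ρ := by
  have hc : Continuous fun x : ℝ => Complex.exp (t * x * Complex.I) := by fun_prop
  have hint : Integrable (fun p : ℝ × ℝ => Complex.exp (t * p.2 * Complex.I))
      (ρ ⊗ₘ centredNormalKernel) := by
    refine Integrable.of_bound (C := 1) (by fun_prop) (ae_of_all _ fun x => ?_)
    rw [← Complex.ofReal_mul, Complex.norm_exp_ofReal_mul_I]
  rw [charFun_apply_real, mixedCentredNormal, ← Measure.snd_compProd, Measure.snd,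
    integral_map measurable_snd.aemeasurable hc.aestronglyMeasurable,
    Measure.integral_compProd hint]
  refine integral_congr_ae (ae_of_all _ fun x => ?_)
  have := charFun_gaussianReal (μ := 0) (v := x.toNNReal) t
  rw [charFun_apply_real] at this
  refine Eq.trans this ?_
  push_cast
  congr 1
  rw [Real.coe_toNNReal']
  ring

instance (ρ : Measure ℝ) [IsProbabilityMeasure ρ] : IsProbabilityMeasure (mixedCentredNormal ρ) := by
  rw [mixedCentredNormal]
  infer_instance

/-- A mixed centred normal distribution as the law of a product. -/
lemma hasLaw_mixedCentredNormal {Ω' : Type*} [MeasurableSpace Ω'] {P' : Measure Ω'}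
    [IsProbabilityMeasure P'] {W N : Ω' → ℝ} (hW : Measurable W) (hN : Measurable N)
    (hW0 : ∀ᵐ ω ∂P', 0 ≤ W ω) (hNlaw : HasLaw N (gaussianReal 0 1) P') (hind : IndepFun W N P') :
    HasLaw (fun ω => √(W ω) * N ω) (mixedCentredNormal (P'.map W)) P' where
  aemeasurable := by fun_prop
  map_eq := by
    have := Measure.isProbabilityMeasure_map (μ := P') hW.aemeasurable
    have : IsProbabilityMeasure (P'.map fun ω => √(W ω) * N ω) :=
      Measure.isProbabilityMeasure_map (by fun_prop)
    refine Measure.ext_of_charFun (funext fun t => ?_)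
    have hjoint := (indepFun_iff_map_prod_eq_prod_map_map hW.aemeasurable hN.aemeasurable).1 hind
    rw [hNlaw.map_eq] at hjoint
    have hc : Measurable fun p : ℝ × ℝ => Complex.exp (t * (√p.1 * p.2 : ℝ) * Complex.I) := by
      fun_prop
    have hint : Integrable (fun p : ℝ × ℝ => Complex.exp (t * (√p.1 * p.2 : ℝ) * Complex.I))
        ((P'.map W).prod (gaussianReal 0 1)) := by
      refine Integrable.of_bound (C := 1) hc.aestronglyMeasurable (ae_of_all _ fun x => ?_)
      rw [← Complex.ofReal_mul, Complex.norm_exp_ofReal_mul_I]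
    have h0 : ∀ᵐ x ∂(P'.map W), 0 ≤ x := (ae_map_iff hW.aemeasurable measurableSet_Ici).2 hW0
    have e : ∫ ω, Complex.exp (t * (√(W ω) * N ω : ℝ) * Complex.I) ∂P'
        = ∫ p : ℝ × ℝ, Complex.exp (t * (√p.1 * p.2 : ℝ) * Complex.I)
          ∂(P'.map fun ω => (W ω, N ω)) := by
      rw [integral_map (by fun_prop) hc.aestronglyMeasurable]
    rw [charFun_mixedCentredNormal, charFun_apply_real, integral_map (by fun_prop) (by fun_prop),
      e, hjoint, integral_prod _ hint]
    refine integral_congr_ae ?_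
    filter_upwards [h0] with x hx
    have := charFun_gaussianReal (μ := 0) (v := 1) (t * √x)
    rw [charFun_apply_real] at this
    have e2 : (fun y : ℝ => Complex.exp (t * (√x * y : ℝ) * Complex.I))
        = fun y : ℝ => Complex.exp ((t * √x : ℝ) * y * Complex.I) := by
      ext y
      congr 1
      push_cast
      ring
    rw [e2, this, max_eq_left hx, Complex.ofReal_exp]
    congr 1
    have hs : (√x : ℂ) ^ 2 = x := by exact_mod_cast Real.sq_sqrt hx
    push_cast
    rw [mul_pow, hs]
    ring

-- Conditioning on the tree turns the characteristic function of the barycentre at `t` into the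
-- expectation of `exp (-t² v U_n / (2 n²))`. This is a bounded continuous function of `U_n / n²`,
-- with the maximum making it bounded on negative arguments too.
open scoped Topology in
lemma IsRecursiveSet.tendstoInDistribution_barycentre {Ω : Type*} [MeasurableSpace Ω]
    {P : Measure Ω} [IsProbabilityMeasure P] {J : ℕ → Ω → ℕ} {X : ℕ → Ω → ℝ} {v : ℝ≥0}
    (h : IsRecursiveSet 1 (normalKernel v) J X P) {Ω' : Type*} [MeasurableSpace Ω']
    {P' : Measure Ω'} [IsProbabilityMeasure P'] {U Z : Ω' → ℝ} (hUm : Measurable U)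
    (hU : TendstoInDistribution (fun (n : ℕ) ω => (treeU (fun k => J k ω) n : ℝ) / (n : ℝ) ^ 2)
      atTop U (fun _ => P) P')
    (hZ : HasLaw Z (mixedCentredNormal (P'.map fun ω => v * U ω)) P') :
    TendstoInDistribution (fun (n : ℕ) ω => barycentre X n ω) atTop Z (fun _ => P) P' := by
  have hX := h.measurable
  have hm : ∀ n, Measurable fun ω => barycentre X n ω := fun n => by
    simp only [barycentre]
    fun_prop
  refine tendstoInDistribution_of_tendsto_charFun (fun n => (hm n).aemeasurable) hZ.aemeasurable
    fun t => ?_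
  have : IsProbabilityMeasure (P'.map fun ω => v * U ω) :=
    Measure.isProbabilityMeasure_map (by fun_prop)
  let f : ℝ → ℝ := fun x => Real.exp (-(t ^ 2 / 2 * max (v * x) 0))
  have hfc : Continuous f := by fun_prop
  let F : BoundedContinuousFunction ℝ ℝ := BoundedContinuousFunction.ofNormedAddCommGroup f hfc 1
    fun x => by
      rw [Real.norm_of_nonneg (Real.exp_nonneg _)]
      have : 0 ≤ t ^ 2 / 2 * max (v * x) 0 := by positivity
      exact Real.exp_le_one_iff.2 (by linarith)
  have hlim := ProbabilityMeasure.tendsto_iff_forall_integral_tendsto.1 hU.tendsto F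
  have hlim' : Tendsto (fun n : ℕ => ((∫ ω, f ((treeU (fun k => J k ω) n : ℝ) / (n : ℝ) ^ 2) ∂P : ℝ) : ℂ))
      atTop (𝓝 ((∫ ω, f (U ω) ∂P' : ℝ) : ℂ)) := by
    refine (Complex.continuous_ofReal.tendsto _).comp ?_
    have e1 : ∀ n : ℕ, ∫ x, F x ∂(P.map fun ω => (treeU (fun k => J k ω) n : ℝ) / (n : ℝ) ^ 2)
        = ∫ ω, f ((treeU (fun k => J k ω) n : ℝ) / (n : ℝ) ^ 2) ∂P := fun n =>
      integral_map (hU.forall_aemeasurable n) hfc.aestronglyMeasurable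
    have e2 : ∫ x, F x ∂(P'.map U) = ∫ ω, f (U ω) ∂P' :=
      integral_map hUm.aemeasurable hfc.aestronglyMeasurable
    rw [← e2]
    exact hlim.congr e1
  have hZc : charFun (P'.map Z) t = ((∫ ω, f (U ω) ∂P' : ℝ) : ℂ) := by
    rw [hZ.map_eq, charFun_mixedCentredNormal, integral_map (by fun_prop) (by fun_prop),
      ← integral_complex_ofReal]
  rw [hZc]
  -- Shifting the index avoids the division by zero at `n = 0` and matches trees with vertices `0,
  -- …, n`.
  refine (tendsto_add_atTop_iff_nat 1).1 (((tendsto_add_atTop_iff_nat 1).2 hlim').congr fun n => ?_)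
  have hn : ((n + 1 : ℕ) : ℝ) ≠ 0 := by positivity
  have hkey := h.integral_mul_exp_sum n (A := fun _ _ => t / ((n + 1 : ℕ) : ℝ)) (G := fun _ => 1)
    (fun _ => measurable_const) measurable_const (by simp)
  simp only [one_mul] at hkey
  rw [charFun_apply_real, integral_map (hm _).aemeasurable (by fun_prop)]
  have e3 : ∀ ω, Complex.exp (t * (barycentre X (n + 1) ω : ℝ) * Complex.I) = Complex.exp
      ((∑ k ∈ Finset.range (n + 1), t / ((n + 1 : ℕ) : ℝ) * X k ω : ℝ) * Complex.I) := fun ω => by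
    rw [barycentre, ← Finset.mul_sum, ← Complex.ofReal_mul]
    congr 3
    ring
  simp only [e3]
  rw [hkey, ← integral_complex_ofReal]
  refine integral_congr_ae ?_
  filter_upwards [h.hoppe.treeU_ae_eq n] with ω hω
  have e4 := subtreeSq_smul (fun k => J k ω) n (t / ((n + 1 : ℕ) : ℝ)) fun _ => 1
  simp only [mul_one] at e4
  have h0 := subtreeSq_nonneg (fun k => J k ω) n fun _ => 1
  simp only [f]
  rw [hω, e4, max_eq_left (by positivity), Complex.ofReal_exp]
  congr 1
  push_cast
  field_simp

/-- Independent random variables `U`, `U*`, `V` and `N`, where `U` and `U*` have distribution `μ`,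
`V` is uniform on `[0, 1]` and `N` is standard normal. -/
lemma exists_indep_quadruple (μ : Measure ℝ) [IsProbabilityMeasure μ] :
    ∃ (Ω' : Type) (_ : MeasurableSpace Ω') (P' : Measure Ω') (_ : IsProbabilityMeasure P')
      (U Ustar V N : Ω' → ℝ), (Measurable U ∧ Measurable Ustar ∧ Measurable V ∧ Measurable N) ∧
      (HasLaw U μ P' ∧ HasLaw Ustar μ P' ∧ HasLaw V unifMeasure P' ∧
        HasLaw N (gaussianReal 0 1) P') ∧
      iIndepFun (β := fun _ => ℝ) ![U, Ustar, V] P' ∧ IndepFun U N P' := by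
  have : ∀ i : Fin 4, IsProbabilityMeasure
      ((![μ, μ, unifMeasure, gaussianReal 0 1] : Fin 4 → Measure ℝ) i) := by
    intro i
    fin_cases i
    · exact inferInstanceAs (IsProbabilityMeasure μ)
    · exact inferInstanceAs (IsProbabilityMeasure μ)
    · exact inferInstanceAs (IsProbabilityMeasure unifMeasure)
    · exact inferInstanceAs (IsProbabilityMeasure (gaussianReal 0 1))
  obtain ⟨Ω', mΩ', P', X, hm, hlaw, hind, hP'⟩ := exists_hasLaw_indepFun (fun _ : Fin 4 => ℝ)
    (![μ, μ, unifMeasure, gaussianReal 0 1] : Fin 4 → Measure ℝ)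
  refine ⟨Ω', mΩ', P', hP', X 0, X 1, X 2, X 3, ⟨hm 0, hm 1, hm 2, hm 3⟩,
    ⟨hlaw 0, hlaw 1, hlaw 2, hlaw 3⟩, ?_, hind.indepFun (by decide)⟩
  have h := hind.precomp (g := Fin.castSucc) (Fin.castSucc_injective 3)
  convert h using 1
  ext i : 1
  fin_cases i <;> rfl

lemma map_fixFun_eq_fixMap {Ω' : Type*} [MeasurableSpace Ω'] {P' : Measure Ω'}
    [IsProbabilityMeasure P'] {μ : Measure ℝ} {U Ustar V : Ω' → ℝ} (hU : Measurable U)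
    (hUstar : Measurable Ustar) (hV : Measurable V) (hUlaw : HasLaw U μ P')
    (hUstarlaw : HasLaw Ustar μ P') (hVlaw : HasLaw V unifMeasure P')
    (hind : iIndepFun (β := fun _ => ℝ) ![U, Ustar, V] P') :
    P'.map (fun ω => V ω ^ 2 * Ustar ω + (1 - V ω) ^ 2 * U ω + V ω ^ 2) = fixMap μ := by
  have hmeas : ∀ i, Measurable ((![U, Ustar, V] : Fin 3 → Ω' → ℝ) i) := by
    intro i
    fin_cases i
    · exact hU
    · exact hUstar
    · exact hV
  have h1 : IndepFun Ustar U P' := hind.indepFun (i := 1) (j := 0) (by decide)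
  have h2 : IndepFun (fun ω => (Ustar ω, U ω)) V P' :=
    hind.indepFun_prodMk hmeas 1 0 2 (by decide) (by decide)
  have h3 := (indepFun_iff_map_prod_eq_prod_map_map hUstar.aemeasurable hU.aemeasurable).1 h1
  have h4 := (indepFun_iff_map_prod_eq_prod_map_map hV.aemeasurable
    (hUstar.prodMk hU).aemeasurable).1 h2.symm
  rw [hUlaw.map_eq, hUstarlaw.map_eq] at h3
  rw [h3, hVlaw.map_eq] at h4
  rw [fixMap, ← h4, Measure.map_map measurable_fixFun (hV.prodMk (hUstar.prodMk hU))]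
  rfl

theorem mainTheorem3 :
    ∃ (Ω' : Type) (_ : MeasurableSpace Ω') (P' : Measure Ω') (_ : IsProbabilityMeasure P')
      (U Ustar V : Ω' → ℝ),
      -- the fixpoint equation
      iIndepFun (β := fun _ => ℝ) ![U, Ustar, V] P' ∧
      pdf.IsUniform V (Icc (0 : ℝ) 1) P' ∧
      IdentDistrib U Ustar P' P' ∧
      IdentDistrib U (fun ω => V ω ^ 2 * Ustar ω + (1 - V ω) ^ 2 * U ω + V ω ^ 2) P' P' ∧
      -- the first two moments
      (∀ᵐ ω ∂P', 0 ≤ U ω) ∧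
      MemLp U 2 P' ∧
      (∫ ω, U ω ∂P') = 1 ∧
      (∫ ω, U ω ^ 2 ∂P') = 11 / 9 ∧
      -- convergence in distribution for the random recursive tree
      (∀ (Ω : Type*) [MeasurableSpace Ω] (P : Measure Ω) [IsProbabilityMeasure P]
        (J : ℕ → Ω → ℕ), IsHoppeSequence 1 J P →
        TendstoInDistribution
          (fun (n : ℕ) ω => (treeU (fun k => J k ω) n : ℝ) / (n : ℝ) ^ 2) atTop U
          (fun _ => P) P') ∧
      -- the barycentre for normal jumps; the random variance is `σ ^ 2 * U`
      (∀ σ : ℝ≥0, 0 < σ →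
        (∫ ω, (σ : ℝ) ^ 2 * U ω ∂P') = (σ : ℝ) ^ 2 ∧
        variance (fun ω => (σ : ℝ) ^ 2 * U ω) P' = 2 / 9 * (σ : ℝ) ^ 4 ∧
        ∃ Z : Ω' → ℝ,
          HasLaw Z (mixedCentredNormal (P'.map fun ω => (σ : ℝ) ^ 2 * U ω)) P' ∧
          ∀ (Ω : Type*) [MeasurableSpace Ω] (P : Measure Ω) [IsProbabilityMeasure P]
            (J : ℕ → Ω → ℕ) (X : ℕ → Ω → ℝ), IsRecursiveSet 1 (normalKernel (σ ^ 2)) J X P →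
            TendstoInDistribution (fun (n : ℕ) ω => barycentre X n ω) atTop Z
              (fun _ => P) P') := by
  obtain ⟨μ, hμ, hfix, hpos, hint, hint2, hm1, hm2⟩ := exists_fixMap_eq
  obtain ⟨Ω', mΩ', P', hP', U, Ustar, V, N, ⟨hU, hUs, hV, hN⟩, ⟨lU, lUs, lV, lN⟩, hind, hUN⟩ :=
    exists_indep_quadruple μ
  have hU0 : ∀ᵐ ω ∂P', 0 ≤ U ω := by
    rw [← lU.map_eq] at hpos
    exact (ae_map_iff hU.aemeasurable measurableSet_Ici).1 hpos
  have hUsq : Integrable (fun ω => U ω ^ 2) P' := by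
    rw [← lU.map_eq] at hint2
    exact hint2.comp_measurable hU
  have hUL2 : MemLp U 2 P' := (memLp_two_iff_integrable_sq hU.aestronglyMeasurable).2 hUsq
  have hE1 : ∫ ω, U ω ∂P' = 1 := by
    rw [← hm1, ← lU.map_eq, integral_map hU.aemeasurable (by fun_prop)]
  have hE2 : ∫ ω, U ω ^ 2 ∂P' = 11 / 9 := by
    rw [← hm2, ← lU.map_eq, integral_map hU.aemeasurable (by fun_prop)]
  have hvar : variance U P' = 2 / 9 := by
    rw [variance_eq_sub hUL2, hE1]
    change ∫ ω, U ω ^ 2 ∂P' - 1 ^ 2 = 2 / 9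
    rw [hE2]
    norm_num
  refine ⟨Ω', mΩ', P', hP', U, Ustar, V, hind, ?_, ?_, ?_, hU0, hUL2, hE1, hE2, ?_, ?_⟩
  · rw [pdf.IsUniform, lV.map_eq, ProbabilityTheory.cond]
    simp
  · exact ⟨hU.aemeasurable, hUs.aemeasurable, by rw [lU.map_eq, lUs.map_eq]⟩
  · exact ⟨hU.aemeasurable, by fun_prop, by
      rw [map_fixFun_eq_fixMap hU hUs hV lU lUs lV hind, hfix, lU.map_eq]⟩
  · intro Ω _ P _ J hJ
    exact hJ.tendstoInDistribution_treeU hfix hpos hint hm1 lU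
  · intro σ _
    -- The limit is realised as `√(σ² U) N` with `N` standard normal and independent of `U`, which
    -- is why the probability space carries a fourth variable.
    refine ⟨by rw [integral_const_mul, hE1, mul_one], by
      rw [variance_const_mul, hvar]; ring, fun ω => √((σ : ℝ) ^ 2 * U ω) * N ω, ?_, ?_⟩
    · refine hasLaw_mixedCentredNormal (by fun_prop) hN ?_ lN
        (hUN.comp (φ := fun x => (σ : ℝ) ^ 2 * x) (by fun_prop) measurable_id)
      filter_upwards [hU0] with ω hω
      positivity
    · intro Ω _ P _ J X hX
      refine hX.tendstoInDistribution_barycentre hU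
        (hX.hoppe.tendstoInDistribution_treeU hfix hpos hint hm1 lU) ?_
      have := hasLaw_mixedCentredNormal (W := fun ω => (σ : ℝ) ^ 2 * U ω) (by fun_prop) hN
        (by filter_upwards [hU0] with ω hω; positivity) lN
        (hUN.comp (φ := fun x => (σ : ℝ) ^ 2 * x) (by fun_prop) measurable_id)
      simpa using this
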